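/- **Setting.** Let $\Pi$ be a finite non-empty set of decisions, $\mathcal O$ a metric space of observations, and $\mathcal M$ a non-empty compact metric space of models. Under model $M\in\mathcal M$, decision $\pi$ produces an observation with law $M(\pi)\in\Delta(\mathcal O)$ (a Borel probability measure) and has mean reward $f_M(\pi)\in\mathbb R$; for each $\pi$ the maps $M\mapsto M(\pi)$ (weak topology) and $M\mapsto f_M(\pi)$ are continuous, and $(M,\pi)\mapsto M(\pi)$ is a Markov kernel. In round $t=1,\dots,T$ an environment picks $M_t\in\mathcal M$ as a measurable function of the past decisions and observations, the player draws $\pi_t\sim p_t$, where $p_t$ depends measurably on the past, and observes $o_t\sim M_t(\pi_t)$. The regret is $\mathrm{Reg}_T=\sup_{\pi^*\in\Pi}\mathbb E\big[\sum_{t\le T}f_{M_t}(\pi^*)-f_{M_t}(\pi_t)\big]$. **Notation.** For a belief $\nu\in\Delta(\mathcal M\times\Pi)$ on $(M,\pi^*)$ and $p\in\Delta(\Pi)$, let $\pi\sim p$ be independent of $(M,\pi^*)\sim\nu$, and let $o\sim M(\pi)$. Write $\nu_{\pi^*}$ for the marginal of $\pi^*$, $\nu_{\pi^*|\pi,o}$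 for the posterior distribution of $\pi^*$ given $(\pi,o)$, and $\nu_{o|\pi}$ for the law of $o$ given $\pi$. For $\eta>0$ and $q$ in the interior of $\Delta(\Pi)$ put $$\mathrm{AIR}_{q,\eta}(p,\nu)=\mathbb E_{\nu,p}\Big[f_M(\pi^*)-f_M(\pi)-\tfrac1\eta \mathrm{KL}(\nu_{\pi^*|\pi,o},q)\Big],\qquad \mathrm{IR}(\nu,p)=\frac{\big(\mathbb E_{\nu,p}[f_M(\pi^*)-f_M(\pi)]\big)^2}{\mathbb E_{\nu,p}[\mathrm{KL}(\nu_{\pi^*|\pi,o},\nu_{\pi^*})]}\in[0,\infty]$$ (with $x/0=\infty$ for $x>0$ and $0/0=0$), and $\mathrm{IR}(\mathrm{IDS})=\sup_\nu\inf_p\mathrm{IR}(\nu,p)$. Let $\mathrm{conv}(\mathcal M)$ be the set of mixtures $M_\mu=\int M\,d\mu(M)$, $\mu\in\Delta(\mathcal M)$, with observation laws $M_\mu(\pi)=\int M(\pi)\,d\mu(M)$ and mean rewards $f_{M_\mu}=\int f_M\,d\mu(M)$, and $$\mathrm{DEC}^{\mathrm{KL}}_\eta(\mathrm{conv}(\mathcal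 M))=\sup_{\bar M\in\mathrm{conv}(\mathcal M)}\ \inf_{p\in\Delta(\Pi)}\ \sup_{M\in\mathrm{conv}(\mathcal M)}\mathbb E_{\pi\sim p}\Big[\max_{\pi'}f_M(\pi')-f_M(\pi)-\tfrac1\eta\mathrm{KL}\big(M(\pi),\bar M(\pi)\big)\Big].$$ **Adaptive Minimax Sampling (AMS)** with learning rate $\eta>0$: start from $q_1$ uniform on $\Pi$. In round $t$, find $(p_t,\nu_t)$ solving the saddle point problem $\inf_{p\in\Delta(\Pi)}\sup_{\nu\in\Delta(\mathcal M\times\Pi)}\mathrm{AIR}_{q_t,\eta}(p,\nu)$, i.e. $p_t$ attains the infimum over $p$ of $\sup_\nu\mathrm{AIR}_{q_t,\eta}(p,\nu)$ and $\nu_t$ maximizes $\mathrm{AIR}_{q_t,\eta}(p_t,\cdot)$ (in particular, any saddle point will do); draw $\pi_t\sim p_t$, observe $o_t$, and set $q_{t+1}=(\nu_t)_{\pi^*|\pi_t,o_t}$ (any version of the posterior that makes $q_{t+1}$ a measurable function of the history). **Theorem.** Let $\eta>0$. 1. For every $q$ in the interior of $\Delta(\Pi)$, a saddle point of $\inf_p\sup_\nu\mathrm{AIR}_{q,\eta}(p,\nu)$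 exists. 2. Let $T\in\mathbb N$ and consider any run of AMS with learning rate $\eta$ against any environment, such that the posteriors used in the updates are determined at the observations that occur: for each $t\le T$, for almost every history, $M_t(\pi)\ll(\nu_t)_{o|\pi}$ for all $\pi$ with $p_t(\pi)>0$. Then $$\mathrm{Reg}_T\le\frac{\log|\Pi|}{\eta}+\mathrm{DEC}^{\mathrm{KL}}_\eta(\mathrm{conv}(\mathcal M))\cdot T .$$ If moreover $\eta=2\sqrt{\log|\Pi|/(\mathrm{IR}(\mathrm{IDS})\cdot T)}$ (where $|\Pi|\ge2$, $T\ge1$ and $0<\mathrm{IR}(\mathrm{IDS})<\infty$, so that this is a well-defined positive number), then $$\mathrm{Reg}_T\le\sqrt{\log|\Pi|\cdot\mathrm{IR}(\mathrm{IDS})\cdot T}.$$ -/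

import Mathlib

open MeasureTheory ProbabilityTheory InformationTheory
open scoped ENNReal

noncomputable section

namespace AMS

universe u v w

/-! ### Beliefs, posteriors and the algorithmic information ratio

A model class is a space `M` of models together with
* `obs : Kernel (M × D) O`, where `obs (m, d)` is the law of the observation when decision `d` is
  taken under model `m`;
* `f : M → D → ℝ`, where `f m d` is the mean reward of decision `d` under model `m`. -/

section Information

variable {M D O : Type*} [MeasurableSpace M] [MeasurableSpace D] [MeasurableSpace O]

/-- The law `obs (m, d)` of the observation, as a point of the space of probability measures. -/
def obsLaw (obs : Kernel (M × D) O) [IsMarkovKernel obs] (d : D) (m : M) : ProbabilityMeasure O :=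
  ⟨obs (m, d), inferInstance⟩

/-- The joint law of `((m, d⋆), o)` when `(m, d⋆) ∼ ν` and, given these, `o ∼ obs (m, d)`. -/
def jointLaw (obs : Kernel (M × D) O) (ν : ProbabilityMeasure (M × D)) (d : D) :
    Measure ((M × D) × O) :=
  (ν : Measure (M × D)) ⊗ₘ obs.comap (fun x : M × D => (x.1, d)) (by fun_prop)

instance (obs : Kernel (M × D) O) [IsMarkovKernel obs] (ν : ProbabilityMeasure (M × D)) (d : D) :
    IsProbabilityMeasure (jointLaw obs ν d) := by
  unfold jointLaw; infer_instance

/-- The law of the observation predicted by the belief `ν` when decision `d` is taken. -/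
def predictive (obs : Kernel (M × D) O) (ν : ProbabilityMeasure (M × D)) (d : D) : Measure O :=
  (jointLaw obs ν d).map Prod.snd

/-- The marginal posterior `ν_{π⋆ | d, o}` of the optimal decision: the regular conditional
distribution of `d⋆` given the observation, when decision `d` is taken. It is a kernel from
observations to decisions, determined up to `predictive obs ν d`-null sets. -/
def posterior [StandardBorelSpace D] [Nonempty D] (obs : Kernel (M × D) O) [IsMarkovKernel obs]
    (ν : ProbabilityMeasure (M × D)) (d : D) : Kernel O D :=
  condDistrib (fun x : (M × D) × O => x.1.2) (fun x : (M × D) × O => x.2) (jointLaw obs ν d)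

/-- The expected regret `E [f_m(d⋆) - f_m(d)]` with `d ∼ p` and `(m, d⋆) ∼ ν` independent. -/
def expectedRegret (f : M → D → ℝ) (p : Measure D) (ν : ProbabilityMeasure (M × D)) : ℝ :=
  ∫ d, ∫ x, (f x.1 x.2 - f x.1 d) ∂(ν : Measure (M × D)) ∂p

/-- `E [KL(ν_{π⋆ | d, o}, q)]` with `d ∼ p`, `(m, d⋆) ∼ ν` and `o ∼ obs (m, d)`. -/
def expectedKL [StandardBorelSpace D] [Nonempty D] (obs : Kernel (M × D) O) [IsMarkovKernel obs]
    (p : Measure D) (ν : ProbabilityMeasure (M × D)) (q : Measure D) : ℝ≥0∞ :=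
  ∫⁻ d, ∫⁻ o, klDiv (posterior obs ν d o) q ∂(predictive obs ν d) ∂p

/-- The algorithmic information ratio `AIR_{q,η}(p, ν)`. -/
def air [StandardBorelSpace D] [Nonempty D] (obs : Kernel (M × D) O) [IsMarkovKernel obs]
    (f : M → D → ℝ) (η : ℝ) (q p : Measure D) (ν : ProbabilityMeasure (M × D)) : EReal :=
  (expectedRegret f p ν : EReal) - ((1 / η : ℝ) : EReal) * (expectedKL obs p ν q : EReal)

/-- The information ratio `IR(ν, p)`: the squared expected regret divided by the information
gain, with values in `[0, ∞]` and the conventions `x / 0 = ∞` for `x > 0` and `0 / 0 = 0`. -/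
def informationRatio [StandardBorelSpace D] [Nonempty D] (obs : Kernel (M × D) O)
    [IsMarkovKernel obs] (f : M → D → ℝ) (ν : ProbabilityMeasure (M × D)) (p : Measure D) :
    ℝ≥0∞ :=
  ENNReal.ofReal (expectedRegret f p ν ^ 2) /
    expectedKL obs p ν ((ν : Measure (M × D)).map Prod.snd)

/-- The maximal information ratio of information-directed sampling,
`IR(IDS) = sup_ν inf_p IR(ν, p)`. -/
def irIDS [StandardBorelSpace D] [Nonempty D] (obs : Kernel (M × D) O) [IsMarkovKernel obs]
    (f : M → D → ℝ) : ℝ≥0∞ :=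
  ⨆ ν : ProbabilityMeasure (M × D), ⨅ p : ProbabilityMeasure D, informationRatio obs f ν p

/-! ### The decision-estimation coefficient of the convex hull -/

/-- The KL version of the decision-estimation coefficient of a class of models indexed by `ι`
(model `i` has observation laws `law i d` and mean rewards `r i d`), with reference models
ranging over the family `ref`:
`sup_{j} inf_p sup_i E_{d ∼ p} [max_{d'} r i d' - r i d - (1/η) KL(law i d, ref j d)]`. -/
def decKL {ι κ : Type*} (law : ι → D → Measure O) (r : ι → D → ℝ) (ref : κ → D → Measure O)
    (η : ℝ) : EReal :=
  ⨆ j : κ, ⨅ p : ProbabilityMeasure D, ⨆ i : ι,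
    (((⨆ d' : D, r i d') - ∫ d, r i d ∂(p : Measure D) : ℝ) : EReal)
      - ((1 / η : ℝ) : EReal) * ((∫⁻ d, klDiv (law i d) (ref j d) ∂(p : Measure D) : ℝ≥0∞) : EReal)

/-- Observation laws of the mixture model `∫ m dμ(m)`, a point of the convex hull. -/
def mixLaw (obs : Kernel (M × D) O) (μ : ProbabilityMeasure M) (d : D) : Measure O :=
  (μ : Measure M).bind (fun m => obs (m, d))

/-- Mean rewards of the mixture model `∫ m dμ(m)`. -/
def mixReward (f : M → D → ℝ) (μ : ProbabilityMeasure M) (d : D) : ℝ :=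
  ∫ m, f m d ∂(μ : Measure M)

/-- `DEC^KL_η(conv(M))`, where `conv(M)` consists of the mixtures `∫ m dμ(m)` over all
probability measures `μ` on the model class (so that `conv(conv(M)) = conv(M)`). -/
def decKLConv (obs : Kernel (M × D) O) (f : M → D → ℝ) (η : ℝ) : EReal :=
  decKL (mixLaw obs) (mixReward f) (mixLaw obs) η

/-! ### Saddle points -/

/-- `(p, ν)` is a saddle point of `inf_p sup_ν AIR_{q,η}(p, ν)`. -/
def IsSaddlePoint [StandardBorelSpace D] [Nonempty D] (obs : Kernel (M × D) O)
    [IsMarkovKernel obs] (f : M → D → ℝ) (η : ℝ) (q p : Measure D)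
    (ν : ProbabilityMeasure (M × D)) : Prop :=
  (∀ ν' : ProbabilityMeasure (M × D), air obs f η q p ν' ≤ air obs f η q p ν) ∧
    ∀ p' : ProbabilityMeasure D, air obs f η q p ν ≤ air obs f η q p' ν

/-- `(p, ν)` solves `inf_p sup_ν AIR_{q,η}(p, ν)`: the decision distribution `p` attains the
infimum over `p` of `sup_ν AIR_{q,η}(p, ν)`, and the belief `ν` attains the supremum
`sup_ν AIR_{q,η}(p, ν)` for this `p`. Every saddle point has this property. -/
def SolvesMinimax [StandardBorelSpace D] [Nonempty D] (obs : Kernel (M × D) O)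
    [IsMarkovKernel obs] (f : M → D → ℝ) (η : ℝ) (q p : Measure D)
    (ν : ProbabilityMeasure (M × D)) : Prop :=
  (∀ p' : ProbabilityMeasure D,
      (⨆ ν' : ProbabilityMeasure (M × D), air obs f η q p ν') ≤
        ⨆ ν' : ProbabilityMeasure (M × D), air obs f η q p' ν') ∧
    ∀ ν' : ProbabilityMeasure (M × D), air obs f η q p ν' ≤ air obs f η q p ν

theorem IsSaddlePoint.solvesMinimax [StandardBorelSpace D] [Nonempty D] {obs : Kernel (M × D) O}
    [IsMarkovKernel obs] {f : M → D → ℝ} {η : ℝ} {q p : Measure D}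
    {ν : ProbabilityMeasure (M × D)} (h : IsSaddlePoint obs f η q p ν) :
    SolvesMinimax obs f η q p ν :=
  ⟨fun p' => (iSup_le h.1).trans
    ((h.2 p').trans (le_iSup (fun ν' => air obs f η q p' ν') ν)), h.1⟩

end Information

/-! ### The interaction protocol -/

/-- Histories of `t` rounds, i.e. sequences of `t` pairs (decision, observation). -/
def History (D : Type u) (O : Type v) : ℕ → Type (max u v)
  | 0 => PUnit
  | t + 1 => History D O t × (D × O)

instance instMeasurableSpaceHistory (D : Type u) (O : Type v) [MeasurableSpace D]
    [MeasurableSpace O] : ∀ t, MeasurableSpace (History D O t)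
  | 0 => (⊤ : MeasurableSpace PUnit)
  | t + 1 => @Prod.instMeasurableSpace _ _ (instMeasurableSpaceHistory D O t) inferInstance

section Protocol

variable {M : Type w} {D : Type u} {O : Type v}
  [MeasurableSpace M] [MeasurableSpace D] [MeasurableSpace O]

/-- The law of the history after `t` rounds when in each round `s`, given the past history `h`,
the environment uses the model `env s h`, the decision is drawn from `p s h`, and then the
observation is drawn from `obs (env s h, d)`, where `d` is the decision drawn. -/
def historyLaw (obs : Kernel (M × D) O) (p : ∀ t, Kernel (History D O t) D)
    (env : ∀ t, History D O t → M) (henv : ∀ t, Measurable (env t)) :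
    ∀ t, Measure (History D O t)
  | 0 => Measure.dirac PUnit.unit
  | t + 1 => historyLaw obs p env henv t ⊗ₘ
      (p t ⊗ₖ obs.comap (fun x : History D O t × D => (env t x.1, x.2))
        (((henv t).comp measurable_fst).prodMk measurable_snd))

/-- `∑_{s < t} (f_{M_s}(d⋆) - f_{M_s}(d_s))` along a history of `t` rounds, where `M_s` is the
model used by the environment and `d_s` the decision taken in round `s`. -/
def cumulativeRegret (f : M → D → ℝ) (env : ∀ t, History D O t → M) (dstar : D) :
    ∀ t, History D O t → ℝ
  | 0, _ => 0
  | t + 1, (h, (d, _)) =>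
      cumulativeRegret f env dstar t h + (f (env t h) dstar - f (env t h) d)

/-- The regret `Reg_T = sup_{d⋆} E [∑_t f_{M_t}(d⋆) - ∑_t f_{M_t}(d_t)]`. -/
def regret (obs : Kernel (M × D) O) (f : M → D → ℝ) (p : ∀ t, Kernel (History D O t) D)
    (env : ∀ t, History D O t → M) (henv : ∀ t, Measurable (env t)) (T : ℕ) : ℝ :=
  ⨆ dstar : D, ∫ h, cumulativeRegret f env dstar T h ∂(historyLaw obs p env henv T)

variable [StandardBorelSpace D] [Nonempty D]

/-- Adaptive minimax sampling with learning rate `η` over `T` rounds (numbered from `0`). After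
the history `h` of the first `t` rounds, `q t h` is the reference distribution, `p t h` the
decision distribution and `ν t h` the algorithmic belief:
* the initial reference distribution is uniform;
* in each round, `(p t h, ν t h)` solves `inf_p sup_ν AIR_{q,η}(p, ν)` for the reference
  distribution `q = q t h` (which is asked to lie in the interior of the simplex);
* the next reference distribution is (a version of) the posterior distribution of the optimal
  decision under the belief `ν t h`, given the decision `d` and the observation `o` of round `t`. -/
structure IsAMS (obs : Kernel (M × D) O) [IsMarkovKernel obs] (f : M → D → ℝ) (η : ℝ) (T : ℕ)
    (q p : ∀ t, Kernel (History D O t) D)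
    (ν : ∀ t, History D O t → ProbabilityMeasure (M × D)) : Prop where
  init : ∀ h, q 0 h = uniformOn Set.univ
  solves : ∀ t < T, ∀ h, (∀ d, q t h {d} ≠ 0) → SolvesMinimax obs f η (q t h) (p t h) (ν t h)
  update : ∀ t < T, ∀ h d, ∀ᵐ o ∂(predictive obs (ν t h) d),
    q (t + 1) (h, (d, o)) = posterior obs (ν t h) d o

/-- In (almost) every history that occurs, the law of the observation that the environment
generates is absolutely continuous with respect to the law predicted by the algorithmic belief,
for every decision that may be taken. Hence the posteriors in the updates, which are determined
only up to null sets of the predicted law, are determined almost surely along the run. -/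
def PosteriorsDetermined (obs : Kernel (M × D) O) (p : ∀ t, Kernel (History D O t) D)
    (ν : ∀ t, History D O t → ProbabilityMeasure (M × D)) (env : ∀ t, History D O t → M)
    (henv : ∀ t, Measurable (env t)) (T : ℕ) : Prop :=
  ∀ t < T, ∀ᵐ h ∂(historyLaw obs p env henv t),
    ∀ d, p t h {d} ≠ 0 → obs (env t h, d) ≪ predictive obs (ν t h) d

end Protocol

end AMS

end

set_option linter.unusedSectionVars false

namespace AMS

/-! ### Relative entropy on a finite space -/

section Finite

variable {D : Type*} [Fintype D] [MeasurableSpace D] [MeasurableSingletonClass D]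

/-! Since decisions are finite, `air` is an average over d ∼ p of real numbers `decisionValue`. Each
is an affine weakly continuous functional of the belief ν minus 1/η times `negEntropy`, the mean
over o of ∑ x log x for the posterior x. The duality x log x = sup_u (x u + x - exp u) writes
`negEntropy` as a supremum of functionals linear and continuous in ν (`integral_dualTest_le`,
`exists_negEntropy_le`). It is therefore convex and lower semicontinuous, and posteriors need not be
followed as ν varies. Beliefs form a compact space, so a separation argument (`exists_minimax`)
yields weights p and a belief that certify a common value W. This is the saddle point, and W bounds
the value of every solution of the minimax problem.

At the certifying belief every decision has value at least W, so W can be compared with any p.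
Replacing q by the prior only lowers the divergence, leaving the mutual information I between π* and
o. For the information ratio K, the bound R² ≤ K I and AM-GM give R - I/η ≤ ηK/4
(`le_mul_toReal_irIDS`). For the DEC, split the belief according to the value b of π*. By Bayes'
rule, I is also the prior average of the divergences between the observation law given b and the
predictive law, so some conditional mixture b does at least as well as the average (`le_decKLConv`).

For the regret, fix a comparator a. Maximality of ν_t for p_t is tested against (1-ε)ν_t + ε δ_(M_t,
a). As ε → 0 the first-order condition says that the conditional expectation of -log q_{t+1}(a),
under the true observation law, is at most -log q_t(a) + η (V - regret of the round against a),
where V bounds the minimax values. This telescopes from log |Π|. Since the final log loss is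
nonnegative, the regret is at most log |Π| / η + V T (`lintegral_logLoss_le`, `regret_le`). The
limit is taken by Fatou's lemma, since the log loss may be infinite where the posterior vanishes. -/

theorem rnDeriv_toReal_mul_real_singleton {μ q : Measure D} [IsFiniteMeasure μ]
    [IsFiniteMeasure q] (h : μ ≪ q) (b : D) :
    (μ.rnDeriv q b).toReal * q.real {b} = μ.real {b} := by
  have h1 := Measure.setLIntegral_rnDeriv h {b}
  rw [lintegral_singleton] at h1
  rw [Measure.real, Measure.real, ← ENNReal.toReal_mul, h1]

/-- The relative entropy of probability measures on a finite space as a sum. -/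
theorem klDiv_eq_ofReal_sum {μ q : Measure D} [IsProbabilityMeasure μ] [IsProbabilityMeasure q]
    (h : μ ≪ q) :
    klDiv μ q =
      ENNReal.ofReal (∑ b, μ.real {b} * (Real.log (μ.real {b}) - Real.log (q.real {b}))) := by
  rw [klDiv_of_ac_of_integrable h (Integrable.of_finite), integral_fintype (Integrable.of_finite)]
  simp only [probReal_univ, add_sub_cancel_right]
  congr 1
  refine Finset.sum_congr rfl fun b _ => ?_
  rw [smul_eq_mul]
  by_cases hb : μ.real {b} = 0
  · simp [hb]
  congr 1
  have h1 := rnDeriv_toReal_mul_real_singleton h b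
  have hr : (μ.rnDeriv q b).toReal ≠ 0 := by rintro h0; simp [h0] at h1; exact hb h1.symm
  have hq : q.real {b} ≠ 0 := by rintro h0; simp [h0] at h1; exact hb h1.symm
  rw [llr, ← h1, Real.log_mul hr hq]; ring

theorem absolutelyContinuous_of_real_singleton {μ q : Measure D} [IsFiniteMeasure μ]
    [IsFiniteMeasure q] (h : ∀ b, q.real {b} = 0 → μ.real {b} = 0) : μ ≪ q := by
  intro s hs
  rw [← Set.biUnion_of_singleton s, measure_biUnion_null_iff s.to_countable]
  intro b hb
  have : q {b} = 0 := measure_mono_null (Set.singleton_subset_iff.2 hb) hs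
  have h2 := h b (by simp [Measure.real, this])
  rwa [measureReal_eq_zero_iff] at h2

theorem sum_real_singleton_eq_one (μ : Measure D) [IsProbabilityMeasure μ] :
    ∑ b, μ.real {b} = 1 := by
  simp

/-- Fenchel–Young inequality for the pair x log x - x and exp, obtained from 1 + v ≤ exp v at v = u
- log x. It underlies both Gibbs' inequality and the variational bound on the entropy. -/
theorem mul_add_sub_exp_le_mul_log {x : ℝ} (hx : 0 ≤ x) (u : ℝ) :
    x * u + x - Real.exp u ≤ x * Real.log x := by
  rcases hx.eq_or_lt with rfl | hx
  · simp [Real.exp_nonneg]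
  have := Real.add_one_le_exp (u - Real.log x)
  rw [Real.exp_sub, Real.exp_log hx, le_div_iff₀ hx] at this
  nlinarith

/-- Gibbs' inequality for finite sums. -/
theorem sum_mul_log_le {x y : D → ℝ} (hx : ∀ b, 0 ≤ x b) (hy : ∀ b, 0 ≤ y b)
    (hxy : ∀ b, y b = 0 → x b = 0) (hsum : ∑ b, y b ≤ ∑ b, x b) :
    ∑ b, x b * Real.log (y b) ≤ ∑ b, x b * Real.log (x b) := by
  have key : ∀ b, x b * Real.log (y b) + x b - y b ≤ x b * Real.log (x b) := fun b => by
    rcases (hy b).eq_or_lt with h | h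
    · simp [hxy b h.symm, ← h]
    · have := mul_add_sub_exp_le_mul_log (hx b) (Real.log (y b))
      rwa [Real.exp_log h] at this
  have := Finset.sum_le_sum fun b (_ : b ∈ Finset.univ) => key b
  rw [Finset.sum_sub_distrib, Finset.sum_add_distrib] at this
  linarith

end Finite

/-! ### The posterior as a family of densities -/

section Posterior

variable {M D O : Type*} [MeasurableSpace M] [MeasurableSpace O]
  [Fintype D] [Nonempty D] [MeasurableSpace D] [MeasurableSingletonClass D]
  (obs : Kernel (M × D) O) [IsMarkovKernel obs] (ν : ProbabilityMeasure (M × D)) (d : D)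

/-- The posterior probability that `b` is the optimal decision. -/
noncomputable def postReal (b : D) (o : O) : ℝ := (posterior obs ν d o).real {b}

instance : IsMarkovKernel (posterior obs ν d) := by unfold posterior; infer_instance

instance : IsProbabilityMeasure (predictive obs ν d) := by
  unfold predictive; exact Measure.isProbabilityMeasure_map (by fun_prop)

theorem postReal_nonneg (b : D) (o : O) : 0 ≤ postReal obs ν d b o := measureReal_nonneg

theorem postReal_le_one (b : D) (o : O) : postReal obs ν d b o ≤ 1 := measureReal_le_one

theorem sum_postReal (o : O) : ∑ b, postReal obs ν d b o = 1 := sum_real_singleton_eq_one _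

@[fun_prop]
theorem measurable_postReal (b : D) : Measurable (postReal obs ν d b) :=
  (Kernel.measurable_coe _ (measurableSet_singleton b)).ennreal_toReal

theorem measurable_uncurry_of_forall [Countable D] {E : Type*} [MeasurableSpace E] {u : D → O → E}
    (hu : ∀ b, Measurable (u b)) :
    Measurable fun x : D × O => u x.1 x.2 :=
  measurable_from_prod_countable_right hu

theorem integrable_of_bounded {X : Type*} [MeasurableSpace X] {μ : Measure X} [IsFiniteMeasure μ]
    {g : X → ℝ} (hg : Measurable g) {C : ℝ} (hC : ∀ x, |g x| ≤ C) : Integrable g μ :=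
  Integrable.of_bound hg.aestronglyMeasurable C (ae_of_all _ hC)

/-- Averaging a function of `(d⋆, o)` over the joint law, or over the predictive law and the
posterior. -/
theorem integral_integral_obs {u : D → O → ℝ} (hu : ∀ b, Measurable (u b)) {C : ℝ}
    (hC : ∀ b o, |u b o| ≤ C) :
    ∫ x, (∫ o, u x.2 o ∂obs (x.1, d)) ∂(ν : Measure (M × D)) =
      ∫ o, ∑ b, postReal obs ν d b o * u b o ∂(predictive obs ν d) := by
  have hm : Measurable fun x : D × O => u x.1 x.2 := measurable_uncurry_of_forall hu
  have h1 : ∫ x, (∫ o, u x.2 o ∂obs (x.1, d)) ∂(ν : Measure (M × D)) =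
      ∫ z, u z.1.2 z.2 ∂(jointLaw obs ν d) := by
    unfold jointLaw
    rw [Measure.integral_compProd]
    · rfl
    · exact integrable_of_bounded (hm.comp (by fun_prop : Measurable
        fun z : (M × D) × O => (z.1.2, z.2))) (fun z => hC _ _)
  have h2 := compProd_map_condDistrib (mβ := ‹MeasurableSpace O›) (μ := jointLaw obs ν d)
    (X := fun x : (M × D) × O => x.2) (Y := fun x : (M × D) × O => x.1.2) (by fun_prop)
  have h3 : ∫ z, u z.1.2 z.2 ∂(jointLaw obs ν d) =
      ∫ y, u y.2 y.1 ∂((jointLaw obs ν d).map fun x => (x.2, x.1.2)) := by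
    rw [integral_map (by fun_prop)]
    exact (hm.comp (by fun_prop : Measurable fun y : O × D => (y.2, y.1))).aestronglyMeasurable
  rw [h1, h3, ← h2, Measure.integral_compProd]
  · refine integral_congr_ae (ae_of_all _ fun o => ?_)
    beta_reduce
    rw [integral_fintype (Integrable.of_finite)]
    rfl
  · exact integrable_of_bounded (hm.comp (by fun_prop : Measurable fun y : O × D => (y.2, y.1)))
      (fun z => hC _ _)

theorem integral_obs_eq {g : O → ℝ} (hg : Measurable g) {C : ℝ} (hC : ∀ o, |g o| ≤ C) :
    ∫ x, (∫ o, g o ∂obs (x.1, d)) ∂(ν : Measure (M × D)) = ∫ o, g o ∂(predictive obs ν d) := by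
  rw [integral_integral_obs obs ν d (u := fun _ => g) (fun _ => hg) (fun _ => hC)]
  simp [← Finset.sum_mul, sum_postReal]

/-- The prior probability that `b` is the optimal decision. -/
noncomputable def priorReal (ν : ProbabilityMeasure (M × D)) (b : D) : ℝ :=
  ((ν : Measure (M × D)).map Prod.snd).real {b}

theorem integral_snd_eq_sum (c : D → ℝ) :
    ∫ x, c x.2 ∂(ν : Measure (M × D)) = ∑ b, priorReal ν b * c b := by
  have : IsProbabilityMeasure ((ν : Measure (M × D)).map Prod.snd) :=
    Measure.isProbabilityMeasure_map (by fun_prop)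
  rw [← integral_map (φ := Prod.snd) (f := c) (by fun_prop)
    (Measurable.of_discrete).aestronglyMeasurable, integral_fintype (Integrable.of_finite)]
  rfl

theorem priorReal_nonneg (b : D) : 0 ≤ priorReal ν b := measureReal_nonneg

theorem sum_priorReal : ∑ b, priorReal ν b = 1 := by
  have : IsProbabilityMeasure ((ν : Measure (M × D)).map Prod.snd) :=
    Measure.isProbabilityMeasure_map (by fun_prop)
  exact sum_real_singleton_eq_one _

theorem integral_postReal (b : D) :
    ∫ o, postReal obs ν d b o ∂(predictive obs ν d) = priorReal ν b := by
  classical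
  have h := integral_integral_obs obs ν d (u := fun b' _ => if b' = b then (1 : ℝ) else 0)
    (fun _ => measurable_const) (C := 1) (fun b' _ => by split_ifs <;> simp)
  simp only [integral_const, probReal_univ, one_smul, mul_ite, mul_one, mul_zero,
    Finset.sum_ite_eq', Finset.mem_univ, if_true] at h
  rw [← h, integral_snd_eq_sum ν (fun b' => if b' = b then (1 : ℝ) else 0)]
  simp

theorem postReal_ae_eq_zero {b : D} (hb : priorReal ν b = 0) :
    ∀ᵐ o ∂(predictive obs ν d), postReal obs ν d b o = 0 := by
  have h := integral_postReal obs ν d b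
  rw [hb, integral_eq_zero_iff_of_nonneg (postReal_nonneg obs ν d b)
    (integrable_of_bounded (measurable_postReal obs ν d b) (C := 1) fun o => by
      rw [abs_of_nonneg (postReal_nonneg ..)]; exact postReal_le_one ..)] at h
  exact h

/-- The negative of the expected entropy of the posterior. -/
noncomputable def negEntropy : ℝ :=
  ∫ o, ∑ b, postReal obs ν d b o * Real.log (postReal obs ν d b o) ∂(predictive obs ν d)

theorem abs_mul_log_le_one {x : ℝ} (h0 : 0 ≤ x) (h1 : x ≤ 1) : |x * Real.log x| ≤ 1 := by
  rw [abs_of_nonpos (mul_nonpos_of_nonneg_of_nonpos h0 (Real.log_nonpos h0 h1))]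
  have := mul_add_sub_exp_le_mul_log h0 0
  simp at this; linarith

theorem abs_sum_postReal_mul_le {u : D → ℝ} {C : ℝ} (hC : ∀ b, |u b| ≤ C) (o : O) :
    |∑ b, postReal obs ν d b o * u b| ≤ C := by
  refine (Finset.abs_sum_le_sum_abs _ _).trans ?_
  calc _ ≤ ∑ b, postReal obs ν d b o * C := Finset.sum_le_sum fun b _ => by
        rw [abs_mul, abs_of_nonneg (postReal_nonneg ..)]
        exact mul_le_mul_of_nonneg_left (hC b) (postReal_nonneg ..)
    _ = C := by rw [← Finset.sum_mul, sum_postReal, one_mul]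

theorem integrable_sum_postReal_log :
    Integrable (fun o => ∑ b, postReal obs ν d b o * Real.log (postReal obs ν d b o))
      (predictive obs ν d) := by
  refine integrable_finsetSum _ fun b _ => integrable_of_bounded (by fun_prop) (C := 1) fun o =>
    abs_mul_log_le_one (postReal_nonneg ..) (postReal_le_one ..)

/-- The expected divergence of the posterior from a reference distribution. -/
theorem lintegral_klDiv_posterior (q : Measure D) [IsProbabilityMeasure q]
    (hq : ∀ b, q.real {b} = 0 → priorReal ν b = 0) :
    ∫⁻ o, klDiv (posterior obs ν d o) q ∂(predictive obs ν d) =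
        ENNReal.ofReal (negEntropy obs ν d - ∑ b, priorReal ν b * Real.log (q.real {b})) ∧
      0 ≤ negEntropy obs ν d - ∑ b, priorReal ν b * Real.log (q.real {b}) := by
  -- A decision of prior mass zero has posterior mass zero for almost every o, so it suffices that q
  -- dominates the prior.
  have hac : ∀ᵐ o ∂(predictive obs ν d), posterior obs ν d o ≪ q := by
    have : ∀ᵐ o ∂(predictive obs ν d), ∀ b, q.real {b} = 0 → postReal obs ν d b o = 0 := by
      rw [ae_all_iff]
      intro b
      by_cases hb : q.real {b} = 0
      · filter_upwards [postReal_ae_eq_zero obs ν d (hq b hb)] with o ho _ using ho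
      · exact ae_of_all _ fun o h => absurd h hb
    filter_upwards [this] with o ho using absolutelyContinuous_of_real_singleton ho
  have hI : Integrable (fun o => ∑ b, postReal obs ν d b o * Real.log (q.real {b}))
      (predictive obs ν d) :=
    integrable_finsetSum _ fun b _ => (integrable_of_bounded (measurable_postReal obs ν d b) (C := 1)
      fun o => by rw [abs_of_nonneg (postReal_nonneg ..)]; exact postReal_le_one ..).mul_const _
  have hint : negEntropy obs ν d - ∑ b, priorReal ν b * Real.log (q.real {b}) =
      ∫ o, ∑ b, postReal obs ν d b o *
        (Real.log (postReal obs ν d b o) - Real.log (q.real {b})) ∂(predictive obs ν d) := by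
    simp only [mul_sub, Finset.sum_sub_distrib]
    rw [integral_sub (integrable_sum_postReal_log obs ν d) hI, negEntropy]
    congr 1
    rw [integral_finsetSum]
    · simp only [integral_mul_const, integral_postReal]
    · exact fun b _ => (integrable_of_bounded (measurable_postReal obs ν d b) (C := 1)
        fun o => by rw [abs_of_nonneg (postReal_nonneg ..)]; exact postReal_le_one ..).mul_const _
  have hnn : 0 ≤ᵐ[predictive obs ν d] fun o => ∑ b, postReal obs ν d b o *
        (Real.log (postReal obs ν d b o) - Real.log (q.real {b})) := by
    filter_upwards [hac] with o ho
    simp only [mul_sub, Finset.sum_sub_distrib, Pi.zero_apply, sub_nonneg]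
    refine sum_mul_log_le (fun b => postReal_nonneg ..) (fun b => measureReal_nonneg) ?_ ?_
    · intro b hb
      have := ho ((measureReal_eq_zero_iff).1 hb)
      simp [postReal, Measure.real, this]
    · rw [sum_postReal]; simp
  rw [hint]
  refine ⟨?_, integral_nonneg_of_ae hnn⟩
  rw [ofReal_integral_eq_lintegral_ofReal _ hnn]
  · refine lintegral_congr_ae ?_
    filter_upwards [hac] with o ho using klDiv_eq_ofReal_sum ho
  · simp only [mul_sub, Finset.sum_sub_distrib]
    exact (integrable_sum_postReal_log obs ν d).sub hI

end Posterior

open scoped BoundedContinuousFunction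

/-! ### A variational formula for the negative entropy -/

section DualTest

variable {D O : Type*} [Fintype D]

/-- The function whose expectation lower bounds the negative entropy of the posterior. -/
noncomputable def dualTest (u : D → O → ℝ) (b : D) (o : O) : ℝ :=
  u b o + 1 - ∑ c, Real.exp (u c o)

theorem measurable_dualTest [MeasurableSpace O] {u : D → O → ℝ} (hu : ∀ b, Measurable (u b)) (b : D) :
    Measurable (dualTest u b) := by
  unfold dualTest; fun_prop

theorem abs_dualTest_le {u : D → O → ℝ} {C : ℝ} (hC : ∀ b o, |u b o| ≤ C) (b : D) (o : O) :
    |dualTest u b o| ≤ C + 1 + Fintype.card D * Real.exp C := by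
  have h1 : ∑ c, Real.exp (u c o) ≤ Fintype.card D * Real.exp C := by
    refine (Finset.sum_le_card_nsmul _ _ (Real.exp C) fun c _ => ?_).trans_eq (by simp)
    exact Real.exp_le_exp.2 ((abs_le.1 (hC c o)).2)
  have h2 : 0 ≤ ∑ c, Real.exp (u c o) := Finset.sum_nonneg fun c _ => (Real.exp_pos _).le
  have h3 := abs_le.1 (hC b o)
  unfold dualTest
  rw [abs_le]; constructor <;> linarith

theorem sum_mul_dualTest {x : D → ℝ} (hx : ∑ b, x b = 1) (u : D → O → ℝ) (o : O) :
    ∑ b, x b * dualTest u b o = ∑ b, (x b * u b o + x b - Real.exp (u b o)) := by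
  simp only [dualTest, mul_sub, mul_add, Finset.sum_sub_distrib, Finset.sum_add_distrib,
    ← Finset.sum_mul, hx, mul_one, one_mul]

end DualTest

section Variational

variable {M D O : Type*} [MeasurableSpace M] [MeasurableSpace O]
  [Fintype D] [Nonempty D] [MeasurableSpace D] [MeasurableSingletonClass D]
  (obs : Kernel (M × D) O) [IsMarkovKernel obs] (ν : ProbabilityMeasure (M × D)) (d : D)

theorem integrable_sum_postReal_mul {u : D → O → ℝ} (hu : ∀ b, Measurable (u b)) {C : ℝ}
    (hC : ∀ b o, |u b o| ≤ C) :
    Integrable (fun o => ∑ b, postReal obs ν d b o * u b o) (predictive obs ν d) :=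
  integrable_of_bounded (by fun_prop) (C := C) fun o =>
    abs_sum_postReal_mul_le obs ν d (fun b => hC b o) o

/-- The variational lower bound of the negative entropy. -/
theorem integral_dualTest_le {u : D → O → ℝ} (hu : ∀ b, Measurable (u b)) {C : ℝ}
    (hC : ∀ b o, |u b o| ≤ C) :
    ∫ x, (∫ o, dualTest u x.2 o ∂obs (x.1, d)) ∂(ν : Measure (M × D)) ≤ negEntropy obs ν d := by
  rw [integral_integral_obs obs ν d (measurable_dualTest hu) (abs_dualTest_le hC)]
  refine integral_mono (integrable_sum_postReal_mul obs ν d (measurable_dualTest hu)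
    (abs_dualTest_le hC)) (integrable_sum_postReal_log obs ν d) fun o => ?_
  beta_reduce
  rw [sum_mul_dualTest (sum_postReal obs ν d o)]
  exact Finset.sum_le_sum fun b _ => mul_add_sub_exp_le_mul_log (postReal_nonneg ..) _

theorem log_sub_log_le {x y δ : ℝ} (hδ : 0 < δ) (hx : δ ≤ x) (hy : δ ≤ y) :
    Real.log x - Real.log y ≤ 1 / δ * |x - y| := by
  have hx' := hδ.trans_le hx
  have hy' := hδ.trans_le hy
  rw [← Real.log_div hx'.ne' hy'.ne']
  refine (Real.log_le_sub_one_of_pos (div_pos hx' hy')).trans ?_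
  rw [div_sub_one hy'.ne']
  calc (x - y) / y ≤ |x - y| / y := by gcongr; exact le_abs_self _
    _ ≤ |x - y| / δ := by gcongr
    _ = _ := by ring

/-- Here h stands for an L¹ approximation of max δ x, possibly outside [δ, 1]. Clipping to [δ, 1] is
1-Lipschitz and fixes max δ x, and log is (1/δ)-Lipschitz above δ. The error δ comes from raising x
to max δ x. -/
theorem mul_log_le_clip {x h δ : ℝ} (hδ : 0 < δ) (hδ1 : δ ≤ 1) (hx0 : 0 ≤ x) (hx1 : x ≤ 1) :
    x * Real.log x ≤ x * Real.log (max δ (min 1 h)) + x - max δ (min 1 h) +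
      (δ + (1 / δ + 1) * |max δ x - h|) := by
  set k := max δ (min 1 h)
  set g := max δ x
  have hg : δ ≤ g := le_max_left _ _
  have hk : δ ≤ k := le_max_left _ _
  have hxg : x ≤ g := le_max_right _ _
  have hgx : g ≤ x + δ := max_le (by linarith) (by linarith)
  have h1 : x * Real.log x ≤ x * Real.log g := by
    rcases hx0.eq_or_lt with h0 | h0
    · simp [← h0]
    · exact mul_le_mul_of_nonneg_left (Real.log_le_log h0 hxg) hx0
  have hgk : |g - k| ≤ |g - h| := by
    have e : g = max δ (min 1 g) := by
      rw [min_eq_right (max_le hδ1 hx1), max_eq_right hg]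
    calc |g - k| = |max δ (min 1 g) - max δ (min 1 h)| := by rw [← e]
      _ ≤ |min 1 g - min 1 h| := by
          simpa using abs_max_sub_max_le_max δ (min 1 g) δ (min 1 h)
      _ ≤ |g - h| := by simpa using abs_min_sub_min_le_max 1 g 1 h
  have h2 : x * (Real.log g - Real.log k) ≤ 1 / δ * |g - k| := by
    have hl := log_sub_log_le hδ hg hk
    have hp : 0 ≤ 1 / δ * |g - k| := by positivity
    nlinarith
  have h3 : k - g ≤ |g - k| := by rw [abs_sub_comm]; exact le_abs_self _
  have h4 : (1 / δ + 1) * |g - k| ≤ (1 / δ + 1) * |g - h| := by gcongr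
  nlinarith

/-- The variational lower bound is sharp, already with bounded continuous test functions. -/
theorem exists_negEntropy_le [TopologicalSpace O] [NormalSpace O] [BorelSpace O]
    [(predictive obs ν d).WeaklyRegular] {ε : ℝ} (hε : 0 < ε) :
    ∃ u : D → O →ᵇ ℝ, negEntropy obs ν d ≤
      ∫ x, (∫ o, dualTest (fun b o => u b o) x.2 o ∂obs (x.1, d)) ∂(ν : Measure (M × D)) + ε := by
  have hn : (0 : ℝ) < Fintype.card D := by exact_mod_cast Fintype.card_pos
  -- Half of ε pays for the errors δ, one per decision; the other half is the L¹ tolerance below,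
  -- divided by the Lipschitz factor 1/δ + 1 and by the number of decisions.
  obtain ⟨δ, hδ, hδ1, hδε⟩ : ∃ δ : ℝ, 0 < δ ∧ δ ≤ 1 ∧ Fintype.card D * δ ≤ ε / 2 :=
    ⟨min 1 (ε / 2 / Fintype.card D), by positivity, min_le_left _ _, by
      rw [mul_comm, ← le_div_iff₀ hn]; exact min_le_right _ _⟩
  have hL : 0 < (1 / δ + 1) * Fintype.card D := by positivity
  have hgi : ∀ b, Integrable (fun o => max δ (postReal obs ν d b o)) (predictive obs ν d) :=
    fun b => integrable_of_bounded (by fun_prop) (C := 1) fun o => by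
      rw [abs_of_nonneg (hδ.le.trans (le_max_left _ _))]
      exact max_le hδ1 (postReal_le_one ..)
  -- The optimal test function is the log of the posterior, neither continuous nor bounded. The
  -- posterior is cut off at δ, approximated in L¹ by bounded continuous functions, and clipped
  -- before taking the log.
  choose h hh1 hh2 using fun b => (hgi b).exists_boundedContinuous_integral_sub_le
    (ε := ε / 2 / ((1 / δ + 1) * Fintype.card D)) (by positivity)
  have hbound : ∀ b o, |Real.log (max δ (min 1 (h b o)))| ≤ |Real.log δ| := fun b o => by
    have h1 : max δ (min 1 (h b o)) ≤ 1 := max_le hδ1 (min_le_left _ _)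
    have h2 : δ ≤ max δ (min 1 (h b o)) := le_max_left _ _
    rw [abs_of_nonpos (Real.log_nonpos (hδ.le.trans h2) h1),
      abs_of_nonpos (Real.log_nonpos hδ.le hδ1)]
    exact neg_le_neg (Real.log_le_log hδ h2)
  let u : D → O →ᵇ ℝ := fun b => BoundedContinuousFunction.ofNormedAddCommGroup
    (fun o => Real.log (max δ (min 1 (h b o))))
    (Continuous.log (by fun_prop) fun o => (hδ.trans_le (le_max_left _ _)).ne') |Real.log δ|
    (fun o => hbound b o)
  have hum : ∀ b, Measurable (fun o => u b o) := fun b => (u b).continuous.measurable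
  have hub : ∀ b o, |u b o| ≤ |Real.log δ| := hbound
  refine ⟨u, ?_⟩
  rw [integral_integral_obs obs ν d (measurable_dualTest hum) (abs_dualTest_le hub)]
  have hi1 := integrable_sum_postReal_mul obs ν d (measurable_dualTest hum) (abs_dualTest_le hub)
  have hi0 : ∀ b, Integrable (fun o => (1 / δ + 1) * |max δ (postReal obs ν d b o) - h b o|)
      (predictive obs ν d) := fun b => ((hgi b).sub (hh2 b)).abs.const_mul _
  have hi2 : ∀ b, Integrable (fun o => δ + (1 / δ + 1) * |max δ (postReal obs ν d b o) - h b o|)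
      (predictive obs ν d) := fun b =>
    (integrable_const _).add (hi0 b)
  have hi3 := integrable_finsetSum Finset.univ fun b _ => hi2 b
  have h1 : negEntropy obs ν d ≤ ∫ o, (∑ b, postReal obs ν d b o * dualTest (fun b o => u b o) b o +
      ∑ b, (δ + (1 / δ + 1) * |max δ (postReal obs ν d b o) - h b o|)) ∂(predictive obs ν d) := by
    refine integral_mono (integrable_sum_postReal_log obs ν d) (hi1.add hi3) fun o => ?_
    beta_reduce
    rw [sum_mul_dualTest (sum_postReal obs ν d o), ← Finset.sum_add_distrib]
    refine Finset.sum_le_sum fun b _ => ?_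
    have := mul_log_le_clip (h := h b o) hδ hδ1 (postReal_nonneg obs ν d b o)
      (postReal_le_one obs ν d b o)
    have e : Real.exp (u b o) = max δ (min 1 (h b o)) :=
      Real.exp_log (hδ.trans_le (le_max_left _ _))
    rw [e]
    exact this
  refine h1.trans ?_
  rw [integral_add hi1 hi3, integral_finsetSum _ fun b _ => hi2 b]
  gcongr
  calc _ ≤ ∑ b : D, (δ + (1 / δ + 1) * (ε / 2 / ((1 / δ + 1) * Fintype.card D))) := by
        refine Finset.sum_le_sum fun b _ => ?_
        rw [integral_add (integrable_const _) (hi0 b), integral_const_mul]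
        simp only [integral_const, probReal_univ, one_smul]
        have := hh1 b
        simp only [Real.norm_eq_abs] at this
        gcongr
    _ = Fintype.card D * δ + ε / 2 := by
        rw [Finset.sum_const, Finset.card_univ, nsmul_eq_mul]
        field_simp
    _ ≤ ε := by linarith

end Variational

/-! ### Convexity and semicontinuity -/

section Convexity

/-- The mixture (1-t) μ₁ + t μ₂ is used only through its integrals of bounded measurable functions,
so only this property is exported. -/
theorem exists_convexCombination {X : Type*} [MeasurableSpace X] (μ₁ μ₂ : ProbabilityMeasure X)
    {t : ℝ} (h0 : 0 ≤ t) (h1 : t ≤ 1) :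
    ∃ μ : ProbabilityMeasure X, ∀ g : X → ℝ, Measurable g → ∀ C, (∀ x, |g x| ≤ C) →
      ∫ x, g x ∂(μ : Measure X) =
        (1 - t) * ∫ x, g x ∂(μ₁ : Measure X) + t * ∫ x, g x ∂(μ₂ : Measure X) := by
  refine ⟨⟨ENNReal.ofReal (1 - t) • (μ₁ : Measure X) + ENNReal.ofReal t • (μ₂ : Measure X), ⟨?_⟩⟩,
    fun g hg C hC => ?_⟩
  · simp [← ENNReal.ofReal_add (sub_nonneg.2 h1) h0]
  · rw [ProbabilityMeasure.coe_mk, integral_add_measure, integral_smul_measure,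
      integral_smul_measure, ENNReal.toReal_ofReal h0, ENNReal.toReal_ofReal (sub_nonneg.2 h1)]
    · rfl
    · exact (integrable_of_bounded hg hC).smul_measure ENNReal.ofReal_ne_top
    · exact (integrable_of_bounded hg hC).smul_measure ENNReal.ofReal_ne_top

variable {M D O : Type*} [MeasurableSpace M]
  [Fintype D] [Nonempty D] [MeasurableSpace D] [MeasurableSingletonClass D]
  [MeasurableSpace O]
  (obs : Kernel (M × D) O) [IsMarkovKernel obs] (d : D)

theorem measurable_integral_obs {v : D → O → ℝ} (hv : ∀ b, Measurable (v b)) :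
    Measurable fun x : M × D => ∫ o, v x.2 o ∂obs (x.1, d) := by
  refine measurable_from_prod_countable_left fun b => ?_
  exact ((hv b).stronglyMeasurable.integral_kernel (κ := obs)).measurable.comp
    (measurable_prodMk_right)

theorem abs_integral_obs_le {v : D → O → ℝ} {C : ℝ} (hC : ∀ b o, |v b o| ≤ C) (x : M × D) :
    |∫ o, v x.2 o ∂obs (x.1, d)| ≤ C := by
  have := norm_integral_le_of_norm_le_const (μ := obs (x.1, d)) (f := fun o => v x.2 o) (C := C)
    (ae_of_all _ fun o => hC x.2 o)
  simpa using this

theorem boundedContinuous_bound [TopologicalSpace O] (u : D → O →ᵇ ℝ) (b : D) (o : O) :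
    |u b o| ≤ ∑ c, ‖u c‖ :=
  ((u b).norm_coe_le_norm o).trans
    (Finset.single_le_sum (f := fun c => ‖u c‖) (fun _ _ => norm_nonneg _) (Finset.mem_univ b))

variable [MetricSpace O] [BorelSpace O]

/-- The negative entropy is a convex function of the belief. -/
theorem negEntropy_le_of_convexCombination {ν₁ ν₂ ν : ProbabilityMeasure (M × D)} {t : ℝ}
    (h0 : 0 ≤ t) (h1 : t ≤ 1)
    (hν : ∀ g : M × D → ℝ, Measurable g → ∀ C, (∀ x, |g x| ≤ C) →
      ∫ x, g x ∂(ν : Measure (M × D)) =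
        (1 - t) * ∫ x, g x ∂(ν₁ : Measure (M × D)) + t * ∫ x, g x ∂(ν₂ : Measure (M × D))) :
    negEntropy obs ν d ≤ (1 - t) * negEntropy obs ν₁ d + t * negEntropy obs ν₂ d := by
  refine le_of_forall_pos_le_add fun ε hε => ?_
  -- One test function, nearly optimal for the mixture, is admissible for both components, and its
  -- functional is linear in the belief: a supremum of linear functionals is convex.
  obtain ⟨u, hu⟩ := exists_negEntropy_le obs ν d hε
  have hm : ∀ b, Measurable (fun o => u b o) := fun b => (u b).continuous.measurable
  have hb := boundedContinuous_bound u
  have hd := abs_dualTest_le hb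
  rw [hν _ (measurable_integral_obs obs d (measurable_dualTest hm)) _
    (abs_integral_obs_le obs d hd)] at hu
  have e1 := integral_dualTest_le obs ν₁ d hm hb
  have e2 := integral_dualTest_le obs ν₂ d hm hb
  have := mul_le_mul_of_nonneg_left e1 (sub_nonneg.2 h1)
  have := mul_le_mul_of_nonneg_left e2 h0
  linarith

/-- The negative entropy is a lower semicontinuous function of the belief. -/
theorem lowerSemicontinuous_negEntropy [TopologicalSpace M] [TopologicalSpace D]
    [DiscreteTopology D] [CompactSpace M] [OpensMeasurableSpace (M × D)]
    (hobs : ∀ d, Continuous fun m : M => obsLaw obs d m) :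
    LowerSemicontinuous fun ν : ProbabilityMeasure (M × D) => negEntropy obs ν d := by
  intro ν y hy
  obtain ⟨u, hu⟩ := exists_negEntropy_le obs ν d (half_pos (sub_pos.2 hy))
  have hm : ∀ b, Measurable (fun o => u b o) := fun b => (u b).continuous.measurable
  have hb := boundedContinuous_bound u
  -- D is discrete, so continuity is checked for each optimal decision b separately, where it is
  -- weak continuity of the observation law in the model.
  have hc : Continuous fun x : M × D =>
      ∫ o, dualTest (fun b o => u b o) x.2 o ∂obs (x.1, d) := by
    rw [continuous_prod_of_discrete_right]
    intro b
    let g : O →ᵇ ℝ := BoundedContinuousFunction.ofNormedAddCommGroup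
      (dualTest (fun b o => u b o) b) (by unfold dualTest; fun_prop) _ (abs_dualTest_le hb b)
    exact ProbabilityMeasure.continuous_iff_forall_continuous_integral.1 (hobs d) g
  have hcont : Continuous fun ν : ProbabilityMeasure (M × D) =>
      ∫ x, (∫ o, dualTest (fun b o => u b o) x.2 o ∂obs (x.1, d)) ∂(ν : Measure (M × D)) :=
    ProbabilityMeasure.continuous_integral_continuousMap (⟨_, hc⟩ : C(M × D, ℝ))
  have hlt : y < ∫ x, (∫ o, dualTest (fun b o => u b o) x.2 o ∂obs (x.1, d))
      ∂(ν : Measure (M × D)) := by linarith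
  filter_upwards [hcont.continuousAt.eventually (lt_mem_nhds hlt)] with ν' hν'
  exact hν'.trans_le (integral_dualTest_le obs ν' d hm hb)

end Convexity

/-! ### A minimax theorem -/

section Minimax

/-- A minimax theorem: for finitely many upper semicontinuous functions on a compact space that
are jointly concave-like, the largest guaranteed value is attained and certified by a convex
combination. -/
theorem exists_minimax {K D : Type*} [TopologicalSpace K] [CompactSpace K] [Nonempty K]
    [Fintype D] [Nonempty D] (A : D → K → ℝ) (husc : ∀ d, UpperSemicontinuous (A d))
    (hconc : ∀ x y (t : ℝ), 0 ≤ t → t ≤ 1 → ∃ z, ∀ d, (1 - t) * A d x + t * A d y ≤ A d z) :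
    ∃ (c : D → ℝ) (x : K) (W : ℝ), (∀ d, 0 ≤ c d) ∧ ∑ d, c d = 1 ∧ (∀ d, W ≤ A d x) ∧
      ∀ y, ∑ d, c d * A d y ≤ W := by
  classical
  have hφ : UpperSemicontinuous fun x => Finset.univ.inf' Finset.univ_nonempty (A · x) := by
    intro x y hy
    obtain ⟨d, -, hd⟩ := (Finset.inf'_lt_iff _).1 hy
    filter_upwards [husc d x y hd] with z hz
    exact (Finset.inf'_le _ (Finset.mem_univ d)).trans_lt hz
  obtain ⟨x, -, hx⟩ := (hφ.upperSemicontinuousOn Set.univ).exists_isMaxOn Set.univ_nonempty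
    isCompact_univ
  set W := Finset.univ.inf' Finset.univ_nonempty (A · x) with hW
  have hmax : ∀ y, ∃ d, A d y ≤ W := fun y => by
    have : Finset.univ.inf' Finset.univ_nonempty (A · y) ≤ W := hx (Set.mem_univ y)
    obtain ⟨d, -, hd⟩ := (Finset.inf'_le_iff Finset.univ_nonempty).1 this
    exact ⟨d, hd⟩
  -- S, the payoff vectors dominated by an attainable one, is convex by the concavity hypothesis; T
  -- is the open orthant above the best guarantee W. They are disjoint because W is maximal, and a
  -- separating functional, normalised, gives the weights.
  let S : Set (D → ℝ) := {v | ∃ y, ∀ d, v d ≤ A d y}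
  let T : Set (D → ℝ) := {v | ∀ d, W < v d}
  have hS : Convex ℝ S := by
    rintro v ⟨y, hy⟩ w ⟨z, hz⟩ a b ha hb hab
    obtain ⟨y', hy'⟩ := hconc y z b hb (by linarith)
    refine ⟨y', fun d => (le_trans ?_ (hy' d))⟩
    rw [← hab, add_sub_cancel_right]
    simp only [Pi.add_apply, Pi.smul_apply, smul_eq_mul]
    exact add_le_add (mul_le_mul_of_nonneg_left (hy d) ha) (mul_le_mul_of_nonneg_left (hz d) hb)
  have hT : T = Set.pi Set.univ fun _ => Set.Ioi W := by ext; simp [T]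
  have hTc : Convex ℝ T := by rw [hT]; exact convex_pi fun _ _ => convex_Ioi W
  have hTo : IsOpen T := by rw [hT]; exact isOpen_set_pi Set.finite_univ fun _ _ => isOpen_Ioi
  have hdisj : Disjoint T S := by
    rw [Set.disjoint_left]
    rintro v hv ⟨y, hy⟩
    obtain ⟨d, hd⟩ := hmax y
    exact absurd ((hv d).trans_le (hy d)) hd.not_gt
  obtain ⟨g, u, hgT, hgS⟩ := geometric_hahn_banach_open hTc hTo hS hdisj
  set c : D → ℝ := fun d => -g (Pi.single d 1) with hc
  have hg : ∀ v, g v = -∑ d, c d * v d := fun v => by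
    conv_lhs => rw [← Finset.univ_sum_single v]
    rw [map_sum, ← Finset.sum_neg_distrib]
    refine Finset.sum_congr rfl fun d _ => ?_
    have : Pi.single d (v d) = v d • (Pi.single d 1 : D → ℝ) := by
      rw [← Pi.single_smul]; simp
    rw [this, map_smul, smul_eq_mul, hc]; ring
  have hcS : ∀ y, ∑ d, c d * A d y ≤ -u := fun y => by
    have := hgS (A · y) ⟨y, fun d => le_rfl⟩
    rw [hg] at this; linarith
  have hc0 : ∀ d, 0 ≤ c d := by
    intro d
    by_contra! hlt
    obtain ⟨y⟩ := ‹Nonempty K›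
    -- S is closed under lowering a coordinate. Were c d negative, lowering coordinate d by this k
    -- would push the functional below its bound u on S.
    set k := (|∑ e, c e * A e y| + |u| + 1) / (-c d) with hk
    have hk0 : 0 ≤ k := div_nonneg (by positivity) (by linarith)
    have hkc : c d * k = -(|∑ e, c e * A e y| + |u| + 1) := by
      have : c d ≠ 0 := hlt.ne
      rw [hk]; field_simp
    have := hgS (fun e => A e y - Pi.single (M := fun _ => ℝ) d k e) ⟨y, fun e => by
      rw [sub_le_self_iff]
      by_cases h : e = d
      · subst h; simpa using hk0
      · simp [h]⟩
    rw [hg] at this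
    simp only [mul_sub, Finset.sum_sub_distrib] at this
    have e : ∑ e, c e * Pi.single (M := fun _ => ℝ) d k e = c d * k := by
      rw [Finset.sum_eq_single d] <;> simp +contextual
    rw [e, hkc] at this
    have h1 := neg_abs_le (∑ e, c e * A e y)
    have h2 := neg_abs_le u
    linarith
  have hcT : ∀ ε > 0, -u < (∑ d, c d) * (W + ε) := fun ε hε => by
    have := hgT (fun _ => W + ε) (fun d => by linarith)
    rw [hg, ← Finset.sum_mul] at this; linarith
  -- If the total weight were zero, all weights would vanish, and the strict separation on T would
  -- contradict the bound on S.
  have hpos : 0 < ∑ d, c d := by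
    refine (Finset.sum_nonneg fun d _ => hc0 d).lt_of_ne fun h0 => ?_
    have h1 := hcT 1 one_pos
    obtain ⟨y⟩ := ‹Nonempty K›
    have h2 := hcS y
    have hz := (Finset.sum_eq_zero_iff_of_nonneg fun d _ => hc0 d).1 h0.symm
    rw [Finset.sum_eq_zero fun d _ => by rw [hz d (Finset.mem_univ d), zero_mul]] at h2
    rw [← h0, zero_mul] at h1
    linarith
  have hWu : -u ≤ (∑ d, c d) * W := by
    refine le_of_forall_pos_le_add fun ε hε => ?_
    have := hcT (ε / ∑ d, c d) (by positivity)
    rw [mul_add, mul_div_cancel₀ _ hpos.ne'] at this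
    exact this.le
  refine ⟨fun d => c d / ∑ d, c d, x, W, fun d => div_nonneg (hc0 d) hpos.le, ?_, fun d =>
    Finset.inf'_le _ (Finset.mem_univ d), fun y => ?_⟩
  · rw [← Finset.sum_div, div_self hpos.ne']
  · simp only [div_mul_eq_mul_div]
    rw [← Finset.sum_div, div_le_iff₀ hpos, mul_comm W]
    exact (hcS y).trans hWu

theorem exists_probabilityMeasure_real_singleton {D : Type*} [Fintype D] [MeasurableSpace D]
    [MeasurableSingletonClass D] {c : D → ℝ} (h0 : ∀ d, 0 ≤ c d) (h1 : ∑ d, c d = 1) :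
    ∃ p : ProbabilityMeasure D, ∀ d, (p : Measure D).real {d} = c d := by
  have hs : ∑ d, ENNReal.ofReal (c d) = 1 := by
    rw [← ENNReal.ofReal_sum_of_nonneg fun d _ => h0 d, h1, ENNReal.ofReal_one]
  refine ⟨⟨(PMF.ofFintype (fun d => ENNReal.ofReal (c d)) hs).toMeasure, inferInstance⟩,
    fun d => ?_⟩
  rw [ProbabilityMeasure.coe_mk, Measure.real,
    PMF.toMeasure_apply_singleton _ _ (measurableSet_singleton d), PMF.ofFintype_apply,
    ENNReal.toReal_ofReal (h0 d)]

end Minimax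

/-! ### The algorithmic information ratio as an average over decisions -/

section Value

variable {M D O : Type*} [MeasurableSpace M] [MeasurableSpace O]
  [Fintype D] [Nonempty D] [MeasurableSpace D] [MeasurableSingletonClass D]
  (obs : Kernel (M × D) O) [IsMarkovKernel obs] (f : M → D → ℝ) (η : ℝ)

/-- The expected regret of the decision `d` under the belief `ν`. -/
noncomputable def decisionRegret (ν : ProbabilityMeasure (M × D)) (d : D) : ℝ :=
  ∫ x, (f x.1 x.2 - f x.1 d) ∂(ν : Measure (M × D))

/-- The expected relative entropy of the posterior with respect to `q` when `d` is taken. -/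
noncomputable def decisionKL (q : Measure D) (ν : ProbabilityMeasure (M × D)) (d : D) : ℝ :=
  negEntropy obs ν d - ∑ b, priorReal ν b * Real.log (q.real {b})

/-- The contribution of the decision `d` to the algorithmic information ratio. -/
noncomputable def decisionValue (q : Measure D) (ν : ProbabilityMeasure (M × D)) (d : D) : ℝ :=
  decisionRegret f ν d - 1 / η * decisionKL obs q ν d

theorem expectedRegret_eq_sum (p : Measure D) [IsProbabilityMeasure p]
    (ν : ProbabilityMeasure (M × D)) :
    expectedRegret f p ν = ∑ d, p.real {d} * decisionRegret f ν d := by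
  rw [expectedRegret, integral_fintype (Integrable.of_finite)]
  rfl

theorem decisionKL_nonneg {q : Measure D} [IsProbabilityMeasure q]
    {ν : ProbabilityMeasure (M × D)} (hq : ∀ b, q.real {b} = 0 → priorReal ν b = 0) (d : D) :
    0 ≤ decisionKL obs q ν d :=
  (lintegral_klDiv_posterior obs ν d q hq).2

theorem expectedKL_eq_ofReal (p : Measure D) [IsProbabilityMeasure p] {q : Measure D}
    [IsProbabilityMeasure q] {ν : ProbabilityMeasure (M × D)}
    (hq : ∀ b, q.real {b} = 0 → priorReal ν b = 0) :
    expectedKL obs p ν q = ENNReal.ofReal (∑ d, p.real {d} * decisionKL obs q ν d) := by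
  rw [expectedKL, lintegral_fintype, ENNReal.ofReal_sum_of_nonneg fun d _ =>
    mul_nonneg measureReal_nonneg (decisionKL_nonneg obs hq d)]
  refine Finset.sum_congr rfl fun d _ => ?_
  rw [(lintegral_klDiv_posterior obs ν d q hq).1, ENNReal.ofReal_mul measureReal_nonneg,
    ofReal_measureReal, mul_comm]
  rfl

/-- When q dominates the prior all divergences are finite, so the extended-real expression is the
coercion of a real number that is linear in p. -/
theorem air_eq_sum (p : Measure D) [IsProbabilityMeasure p] {q : Measure D}
    [IsProbabilityMeasure q] {ν : ProbabilityMeasure (M × D)}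
    (hq : ∀ b, q.real {b} = 0 → priorReal ν b = 0) :
    air obs f η q p ν = ((∑ d, p.real {d} * decisionValue obs f η q ν d : ℝ) : EReal) := by
  rw [air, expectedRegret_eq_sum, expectedKL_eq_ofReal obs p hq, EReal.coe_ennreal_ofReal,
    max_eq_left (Finset.sum_nonneg fun d _ =>
      mul_nonneg measureReal_nonneg (decisionKL_nonneg obs hq d)), ← EReal.coe_mul,
    ← EReal.coe_sub]
  simp only [decisionValue, mul_sub, Finset.sum_sub_distrib, Finset.mul_sum]
  congr 2
  exact Finset.sum_congr rfl fun d _ => mul_left_comm _ _ _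

end Value

/-! ### Existence of saddle points -/

section Saddle

theorem real_singleton_ne_zero {D : Type*} [MeasurableSpace D] {q : Measure D}
    [IsFiniteMeasure q] (hq : ∀ d, q {d} ≠ 0) (d : D) : q.real {d} ≠ 0 := by
  rw [Ne, measureReal_eq_zero_iff]; exact hq d

variable {M D O : Type*} [MeasurableSpace M]
  [Fintype D] [Nonempty D] [MeasurableSpace D] [MeasurableSingletonClass D]

theorem measurable_reward {f : M → D → ℝ} (hf : ∀ d, Measurable fun m => f m d) :
    Measurable fun x : M × D => f x.1 x.2 :=
  measurable_from_prod_countable_left hf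

theorem integral_prior_eq (ν : ProbabilityMeasure (M × D)) (q : Measure D) :
    ∑ b, priorReal ν b * Real.log (q.real {b}) =
      ∫ x, Real.log (q.real {x.2}) ∂(ν : Measure (M × D)) :=
  (integral_snd_eq_sum ν fun b => Real.log (q.real {b})).symm

theorem exists_abs_le_of_finite (c : D → ℝ) : ∃ C, ∀ d, |c d| ≤ C :=
  ⟨∑ d, |c d|, fun d => Finset.single_le_sum (f := fun d => |c d|) (fun _ _ => abs_nonneg _)
    (Finset.mem_univ d)⟩

theorem exists_abs_reward_le [TopologicalSpace M] [CompactSpace M] {f : M → D → ℝ}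
    (hf : ∀ d, Continuous fun m => f m d) : ∃ C, ∀ m d, |f m d| ≤ C := by
  have : ∀ d, ∃ C, ∀ m, |f m d| ≤ C := fun d => by
    obtain ⟨C, hC⟩ := isCompact_univ.exists_bound_of_continuousOn (hf d).continuousOn
    exact ⟨C, fun m => hC m (Set.mem_univ m)⟩
  choose C hC using this
  exact ⟨∑ d, |C d|, fun m d => (hC d m).trans ((le_abs_self _).trans
    (Finset.single_le_sum (f := fun d => |C d|) (fun _ _ => abs_nonneg _) (Finset.mem_univ d)))⟩

theorem decisionRegret_convexCombination {f : M → D → ℝ} (hf : ∀ d, Measurable fun m => f m d)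
    {C : ℝ} (hC : ∀ m d, |f m d| ≤ C) {ν₁ ν₂ ν : ProbabilityMeasure (M × D)} {t : ℝ}
    (hν : ∀ g : M × D → ℝ, Measurable g → ∀ C, (∀ x, |g x| ≤ C) →
      ∫ x, g x ∂(ν : Measure (M × D)) =
        (1 - t) * ∫ x, g x ∂(ν₁ : Measure (M × D)) + t * ∫ x, g x ∂(ν₂ : Measure (M × D)))
    (d : D) :
    decisionRegret f ν d = (1 - t) * decisionRegret f ν₁ d + t * decisionRegret f ν₂ d :=
  hν _ ((measurable_reward hf).sub ((hf d).comp measurable_fst)) (C + C) fun _ =>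
    (abs_sub _ _).trans (add_le_add (hC _ _) (hC _ _))

theorem sum_prior_convexCombination (c : D → ℝ) {ν₁ ν₂ ν : ProbabilityMeasure (M × D)} {t : ℝ}
    (hν : ∀ g : M × D → ℝ, Measurable g → ∀ C, (∀ x, |g x| ≤ C) →
      ∫ x, g x ∂(ν : Measure (M × D)) =
        (1 - t) * ∫ x, g x ∂(ν₁ : Measure (M × D)) + t * ∫ x, g x ∂(ν₂ : Measure (M × D))) :
    ∑ b, priorReal ν b * c b =
      (1 - t) * ∑ b, priorReal ν₁ b * c b + t * ∑ b, priorReal ν₂ b * c b := by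
  obtain ⟨C, hC⟩ := exists_abs_le_of_finite c
  simp only [← integral_snd_eq_sum]
  exact hν _ (Measurable.of_discrete.comp measurable_snd) C fun x => hC _

variable [MetricSpace M] [CompactSpace M] [Nonempty M] [BorelSpace M]
  [MetricSpace O] [MeasurableSpace O] [BorelSpace O]
  (obs : Kernel (M × D) O) [IsMarkovKernel obs]
  (hobs : ∀ d, Continuous fun m : M => obsLaw obs d m)
  {f : M → D → ℝ} (hf : ∀ d, Continuous fun m : M => f m d) {η : ℝ} (hη : 0 < η)

include hobs hf hη

/-- There is a belief that guarantees the minimax value against every decision, and a decision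
distribution that guarantees it against every belief. -/
theorem exists_equalizing (q : Measure D) :
    ∃ (p : ProbabilityMeasure D) (ν : ProbabilityMeasure (M × D)) (W : ℝ),
      (∀ d, W ≤ decisionValue obs f η q ν d) ∧
      ∀ ν', ∑ d, (p : Measure D).real {d} * decisionValue obs f η q ν' d ≤ W := by
  let _ : TopologicalSpace D := ⊥
  have : DiscreteTopology D := ⟨rfl⟩
  have : BorelSpace D := inferInstance
  have hfm : ∀ d, Measurable fun m => f m d := fun d => (hf d).measurable
  obtain ⟨C, hC⟩ := exists_abs_reward_le hf
  have husc : ∀ d, UpperSemicontinuous fun ν : ProbabilityMeasure (M × D) =>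
      decisionValue obs f η q ν d := by
    intro d
    have hR : Continuous fun ν : ProbabilityMeasure (M × D) => decisionRegret f ν d := by
      have : Continuous fun x : M × D => f x.1 x.2 - f x.1 d :=
        (continuous_prod_of_discrete_right.2 fun b => hf b).sub ((hf d).comp continuous_fst)
      exact ProbabilityMeasure.continuous_integral_continuousMap (⟨_, this⟩ : C(M × D, ℝ))
    have hL : Continuous fun ν : ProbabilityMeasure (M × D) =>
        ∑ b, priorReal ν b * Real.log (q.real {b}) := by
      simp only [integral_prior_eq]
      have : Continuous fun x : M × D => Real.log (q.real {x.2}) :=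
        (continuous_of_discreteTopology (f := fun b : D => Real.log (q.real {b}))).comp
          continuous_snd
      exact ProbabilityMeasure.continuous_integral_continuousMap (⟨_, this⟩ : C(M × D, ℝ))
    have hG : UpperSemicontinuous fun ν : ProbabilityMeasure (M × D) =>
        -(1 / η * negEntropy obs ν d) :=
      Continuous.comp_lowerSemicontinuous_antitone (g := fun x : ℝ => -(1 / η * x))
        (by fun_prop) (lowerSemicontinuous_negEntropy obs d hobs) fun x y hxy => by
          have : 0 < 1 / η := by positivity
          exact neg_le_neg (mul_le_mul_of_nonneg_left hxy this.le)
    have := (hR.add (hL.const_mul (1 / η))).upperSemicontinuous.add hG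
    refine (congrArg UpperSemicontinuous (funext fun ν => ?_)).mp this
    simp only [decisionValue, decisionKL, Pi.add_apply]; ring
  have : Nonempty (ProbabilityMeasure (M × D)) :=
    ⟨⟨Measure.dirac (Classical.arbitrary (M × D)), inferInstance⟩⟩
  -- The compact space is that of all beliefs, compact because M × D is.
  obtain ⟨c, ν, W, hc0, hc1, hW, hle⟩ := exists_minimax
    (fun d (ν : ProbabilityMeasure (M × D)) => decisionValue obs f η q ν d) husc
    (by
      intro ν₁ ν₂ t h0 h1
      obtain ⟨ν, hν⟩ := exists_convexCombination ν₁ ν₂ h0 h1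
      refine ⟨ν, fun d => ?_⟩
      have e1 := decisionRegret_convexCombination hfm hC hν d
      have e2 := sum_prior_convexCombination (fun b => Real.log (q.real {b})) hν
      have e3 := negEntropy_le_of_convexCombination obs d h0 h1 hν
      have : 0 < 1 / η := by positivity
      have e4 := mul_le_mul_of_nonneg_left e3 this.le
      simp only [decisionValue, decisionKL, e1, e2]
      linarith)
  obtain ⟨p, hp⟩ := exists_probabilityMeasure_real_singleton hc0 hc1
  exact ⟨p, ν, W, hW, fun ν' => by simpa only [hp] using hle ν'⟩

/-- The certificate p caps every belief at W, while ν gives at least W against every p'; hence the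
value at (p, ν) is W and neither side can improve. -/
theorem exists_isSaddlePoint (q : Measure D) [IsProbabilityMeasure q] (hq : ∀ d, q {d} ≠ 0) :
    ∃ (p : ProbabilityMeasure D) (ν : ProbabilityMeasure (M × D)),
      IsSaddlePoint obs f η q p ν := by
  obtain ⟨p, ν, W, hW, hle⟩ := exists_equalizing obs hobs hf hη q
  have hdom : ∀ ν : ProbabilityMeasure (M × D), ∀ b, q.real {b} = 0 → priorReal ν b = 0 :=
    fun ν b h => absurd h (real_singleton_ne_zero hq b)
  have hge : ∀ p' : ProbabilityMeasure D,
      W ≤ ∑ d, (p' : Measure D).real {d} * decisionValue obs f η q ν d := fun p' => by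
    calc W = ∑ d, (p' : Measure D).real {d} * W := by
          rw [← Finset.sum_mul, sum_real_singleton_eq_one, one_mul]
      _ ≤ _ := Finset.sum_le_sum fun d _ => mul_le_mul_of_nonneg_left (hW d) measureReal_nonneg
  refine ⟨p, ν, fun ν' => ?_, fun p' => ?_⟩
  · rw [air_eq_sum obs f η _ (hdom _), air_eq_sum obs f η _ (hdom _), EReal.coe_le_coe_iff]
    exact (hle ν').trans (hge p)
  · rw [air_eq_sum obs f η _ (hdom _), air_eq_sum obs f η _ (hdom _), EReal.coe_le_coe_iff]
    exact (hle ν).trans (hge p')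

/-- The value of a solution of the minimax problem is guaranteed, against every decision, by some
belief. -/
theorem SolvesMinimax.exists_le_decisionValue {q p : Measure D} [IsProbabilityMeasure q]
    [IsProbabilityMeasure p] (hq : ∀ d, q {d} ≠ 0) {ν : ProbabilityMeasure (M × D)}
    (h : SolvesMinimax obs f η q p ν) :
    ∃ ν' : ProbabilityMeasure (M × D), ∀ d,
      ∑ d, p.real {d} * decisionValue obs f η q ν d ≤ decisionValue obs f η q ν' d := by
  obtain ⟨p', ν', W, hW, hle⟩ := exists_equalizing obs hobs hf hη q
  have hdom : ∀ ν : ProbabilityMeasure (M × D), ∀ b, q.real {b} = 0 → priorReal ν b = 0 :=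
    fun ν b h => absurd h (real_singleton_ne_zero hq b)
  refine ⟨ν', fun d => le_trans ?_ (hW d)⟩
  -- Since p attains the infimum, its supremum over beliefs is at most that of the certifying p',
  -- which is at most W.
  have h1 : air obs f η q p ν ≤ (W : EReal) := by
    refine (le_iSup (fun ν' => air obs f η q p ν') ν).trans ((h.1 p').trans (iSup_le fun ν'' => ?_))
    rw [air_eq_sum obs f η _ (hdom _), EReal.coe_le_coe_iff]
    exact hle ν''
  rwa [air_eq_sum obs f η _ (hdom _), EReal.coe_le_coe_iff] at h1

end Saddle

/-! ### Comparison with the information ratio -/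

section InformationRatio

variable {M D O : Type*} [MeasurableSpace M] [MeasurableSpace O]
  [Fintype D] [Nonempty D] [MeasurableSpace D] [MeasurableSingletonClass D]
  (obs : Kernel (M × D) O) [IsMarkovKernel obs] {f : M → D → ℝ} {η : ℝ}

/-- Among all reference distributions, the prior minimizes the expected divergence. -/
theorem decisionKL_prior_le {q : Measure D} [IsProbabilityMeasure q]
    {ν : ProbabilityMeasure (M × D)} (hq : ∀ b, q.real {b} = 0 → priorReal ν b = 0) (d : D) :
    negEntropy obs ν d - ∑ b, priorReal ν b * Real.log (priorReal ν b) ≤ decisionKL obs q ν d := by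
  rw [decisionKL]
  exact sub_le_sub_left (sum_mul_log_le (priorReal_nonneg ν) (fun b => measureReal_nonneg) hq
    (by rw [sum_priorReal, sum_real_singleton_eq_one])) _

/-- V bounds the value of each decision from below, so it may be averaged over a p that is nearly
optimal for the information ratio at ν. With q replaced by the prior, V ≤ R - I/η, and R² ≤ K I with
AM-GM gives R ≤ ηK/4 + I/η. -/
theorem le_mul_toReal_irIDS (hη : 0 < η) {q : Measure D} [IsProbabilityMeasure q]
    (hq : ∀ d, q {d} ≠ 0) {ν : ProbabilityMeasure (M × D)} {V : ℝ}
    (hV : ∀ d, V ≤ decisionValue obs f η q ν d) (hfin : irIDS obs f ≠ ⊤) :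
    V ≤ η / 4 * (irIDS obs f).toReal := by
  -- The infimum over p in the information ratio is only approached, hence the slack δ.
  suffices h : ∀ δ > 0, V ≤ η / 4 * ((irIDS obs f).toReal + δ) by
    refine le_of_forall_pos_le_add fun ε hε => (h (4 / η * ε) (by positivity)).trans_eq ?_
    field_simp
  intro δ hδ
  have hprob : IsProbabilityMeasure ((ν : Measure (M × D)).map Prod.snd) :=
    Measure.isProbabilityMeasure_map (by fun_prop)
  have hlt : ⨅ p : ProbabilityMeasure D, informationRatio obs f ν p <
      ENNReal.ofReal ((irIDS obs f).toReal + δ) := by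
    refine (le_iSup (fun ν : ProbabilityMeasure (M × D) =>
      ⨅ p : ProbabilityMeasure D, informationRatio obs f ν p) ν).trans_lt ?_
    change irIDS obs f < _
    rw [ENNReal.lt_ofReal_iff_toReal_lt hfin]
    exact lt_add_of_pos_right _ hδ
  obtain ⟨p, hp⟩ := iInf_lt_iff.1 hlt
  set K := (irIDS obs f).toReal + δ
  have hK : 0 ≤ K := add_nonneg ENNReal.toReal_nonneg hδ.le
  set R := ∑ d, (p : Measure D).real {d} * decisionRegret f ν d
  set I := ∑ d, (p : Measure D).real {d} *
    decisionKL obs ((ν : Measure (M × D)).map Prod.snd) ν d with hI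
  have hI0 : 0 ≤ I := Finset.sum_nonneg fun d _ =>
    mul_nonneg measureReal_nonneg (decisionKL_nonneg obs (fun _ h => h) d)
  have hRI : R ^ 2 ≤ K * I := by
    have h := hp.le
    rw [informationRatio, expectedRegret_eq_sum, expectedKL_eq_ofReal obs _ (fun _ h => h),
      ENNReal.div_le_iff_le_mul (Or.inr ENNReal.ofReal_ne_top) (Or.inl ENNReal.ofReal_ne_top),
      ← ENNReal.ofReal_mul hK] at h
    exact (ENNReal.ofReal_le_ofReal_iff (mul_nonneg hK hI0)).1 h
  have hVR : V ≤ R - 1 / η * I := by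
    calc V = ∑ d, (p : Measure D).real {d} * V := by
          rw [← Finset.sum_mul, sum_real_singleton_eq_one, one_mul]
      _ ≤ ∑ d, (p : Measure D).real {d} * (decisionRegret f ν d -
          1 / η * decisionKL obs ((ν : Measure (M × D)).map Prod.snd) ν d) := by
        refine Finset.sum_le_sum fun d _ => mul_le_mul_of_nonneg_left ?_ measureReal_nonneg
        refine (hV d).trans (sub_le_sub_left (mul_le_mul_of_nonneg_left ?_ (by positivity)) _)
        exact decisionKL_prior_le obs (fun b h => absurd h (real_singleton_ne_zero hq b)) d
      _ = _ := by
        simp only [mul_sub, Finset.sum_sub_distrib, R, hI, Finset.mul_sum]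
        congr 1
        exact Finset.sum_congr rfl fun d _ => mul_left_comm _ _ _
  have hamgm : R ≤ η / 4 * K + 1 / η * I := by
    refine (abs_le_of_sq_le_sq' ?_ (by positivity)).2
    have e : K * I = 4 * (η / 4 * K) * (1 / η * I) := by field_simp
    nlinarith [sq_nonneg (η / 4 * K - 1 / η * I)]
  linarith

end InformationRatio

/-! ### Comparison with the decision-estimation coefficient -/

section DEC

variable {M D O : Type*} [MeasurableSpace M] [MeasurableSpace O]
  [Fintype D] [Nonempty D] [MeasurableSpace D] [MeasurableSingletonClass D]
  (obs : Kernel (M × D) O) [IsMarkovKernel obs] (ν : ProbabilityMeasure (M × D))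

open Classical in
/-- Disintegration of a belief along the optimal decision. -/
theorem exists_conditional (b : D) : ∃ μ : ProbabilityMeasure M, ∀ g : M → ℝ, Measurable g →
    priorReal ν b * ∫ m, g m ∂(μ : Measure M) =
      ∫ x, (if x.2 = b then g x.1 else 0) ∂(ν : Measure (M × D)) := by
  have hms : MeasurableSet (Prod.snd ⁻¹' {b} : Set (M × D)) :=
    measurable_snd (measurableSet_singleton b)
  have hind : ∀ g : M → ℝ, ∫ x, (if x.2 = b then g x.1 else 0) ∂(ν : Measure (M × D)) =
      ∫ x in Prod.snd ⁻¹' {b}, g x.1 ∂(ν : Measure (M × D)) := fun g => by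
    rw [← integral_indicator hms]
    rfl
  have hprior : priorReal ν b = (ν : Measure (M × D)).real (Prod.snd ⁻¹' {b}) := by
    rw [priorReal, Measure.real, Measure.map_apply measurable_snd (measurableSet_singleton b)]
    rfl
  simp only [hind]
  -- When b has prior mass zero both sides vanish and any probability measure on models serves.
  by_cases h : (ν : Measure (M × D)) (Prod.snd ⁻¹' {b}) = 0
  · refine ⟨⟨(ν : Measure (M × D)).map Prod.fst,
      Measure.isProbabilityMeasure_map (by fun_prop)⟩, fun g _ => ?_⟩
    rw [hprior, Measure.real, h, Measure.restrict_eq_zero.2 h]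
    simp
  · have hc := cond_isProbabilityMeasure h
    refine ⟨⟨((ν : Measure (M × D))[|Prod.snd ⁻¹' {b}]).map Prod.fst,
      Measure.isProbabilityMeasure_map (by fun_prop)⟩, fun g hg => ?_⟩
    rw [ProbabilityMeasure.coe_mk, integral_map (by fun_prop) hg.aestronglyMeasurable,
      ProbabilityTheory.cond, integral_smul_measure, hprior, smul_eq_mul, ENNReal.toReal_inv,
      ← mul_assoc, Measure.real, mul_inv_cancel₀, one_mul]
    exact (ENNReal.toReal_pos h (measure_ne_top _ _)).ne'

variable (d : D)

theorem measurable_obs_left : Measurable fun m => obs (m, d) :=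
  obs.measurable.comp measurable_prodMk_right

theorem mixLaw_apply (μ : ProbabilityMeasure M) {A : Set O} (hA : MeasurableSet A) :
    mixLaw obs μ d A = ENNReal.ofReal (∫ m, (obs (m, d)).real A ∂(μ : Measure M)) := by
  rw [mixLaw, Measure.bind_apply hA (measurable_obs_left obs d).aemeasurable,
    ofReal_integral_eq_lintegral_ofReal]
  · simp
  · refine integrable_of_bounded ?_ (C := 1) fun m => ?_
    · exact (((Measure.measurable_coe hA).comp (measurable_obs_left obs d))).ennreal_toReal
    · rw [abs_of_nonneg measureReal_nonneg]; exact measureReal_le_one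
  · exact ae_of_all _ fun m => measureReal_nonneg

theorem measurable_obs_real {A : Set O} (hA : MeasurableSet A) :
    Measurable fun m => (obs (m, d)).real A :=
  ((Measure.measurable_coe hA).comp (measurable_obs_left obs d)).ennreal_toReal

/-- The law of the observation under the mean model is the predictive law. -/
theorem mixLaw_map_fst {μ : ProbabilityMeasure M}
    (hμ : (μ : Measure M) = (ν : Measure (M × D)).map Prod.fst) :
    mixLaw obs μ d = predictive obs ν d := by
  ext A hA
  rw [mixLaw_apply obs d _ hA, hμ, integral_map (by fun_prop)
    (measurable_obs_real obs d hA).aestronglyMeasurable]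
  have h := integral_obs_eq obs ν d (g := A.indicator 1) (measurable_one.indicator hA) (C := 1)
    (fun o => by by_cases h : o ∈ A <;> simp [h])
  simp only [integral_indicator_one hA] at h
  rw [h, ofReal_measureReal]

open Classical in
/-- The law of the observation under the model conditioned on the optimal decision `b` has a
density with respect to the predictive law. -/
theorem mixLaw_eq_withDensity {b : D} (hb : priorReal ν b ≠ 0) {μ : ProbabilityMeasure M}
    (hμ : ∀ g : M → ℝ, Measurable g → priorReal ν b * ∫ m, g m ∂(μ : Measure M) =
      ∫ x, (if x.2 = b then g x.1 else 0) ∂(ν : Measure (M × D))) :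
    mixLaw obs μ d = (predictive obs ν d).withDensity
      fun o => ENNReal.ofReal (postReal obs ν d b o / priorReal ν b) := by
  ext A hA
  have hint : Integrable (fun o => postReal obs ν d b o / priorReal ν b)
      ((predictive obs ν d).restrict A) :=
    (integrable_of_bounded (measurable_postReal obs ν d b) (C := 1) fun o => by
      rw [abs_of_nonneg (postReal_nonneg ..)]; exact postReal_le_one ..).div_const _
  rw [mixLaw_apply obs d _ hA, withDensity_apply _ hA, ← ofReal_integral_eq_lintegral_ofReal hint
    (ae_of_all _ fun o => div_nonneg (postReal_nonneg ..) (priorReal_nonneg ..)), integral_div]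
  congr 1
  rw [eq_div_iff hb, mul_comm, hμ _ (measurable_obs_real obs d hA)]
  have h := integral_integral_obs obs ν d (u := fun b' => if b' = b then A.indicator 1 else 0)
    (fun b' => by
      split_ifs
      · exact measurable_one.indicator hA
      · exact measurable_zero) (C := 1)
    (fun b' o => by by_cases h : o ∈ A <;> split_ifs <;> simp [h])
  rw [← integral_indicator hA]
  refine Eq.trans (integral_congr_ae (ae_of_all _ fun x => ?_)) (h.trans
    (integral_congr_ae (ae_of_all _ fun o => ?_)))
  · by_cases hx : x.2 = b
    · simp only [hx, if_true]; rw [integral_indicator_one hA]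
    · simp [hx]
  · beta_reduce
    rw [Finset.sum_eq_single b]
    · by_cases ho : o ∈ A <;> simp [ho]
    · intro b' _ hb'; simp [hb']
    · simp

-- The density is posterior over prior, so the divergence integrates `klFun` of that ratio.
-- Multiplied by the prior and summed over b, the last identity says that the mutual information
-- between π* and o can be computed from either side.
open Classical in
theorem klDiv_mixLaw {b : D} (hb : priorReal ν b ≠ 0) {μ : ProbabilityMeasure M}
    (hμ : ∀ g : M → ℝ, Measurable g → priorReal ν b * ∫ m, g m ∂(μ : Measure M) =
      ∫ x, (if x.2 = b then g x.1 else 0) ∂(ν : Measure (M × D))) :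
    ∃ k : ℝ, 0 ≤ k ∧ klDiv (mixLaw obs μ d) (predictive obs ν d) = ENNReal.ofReal k ∧
      priorReal ν b * k = ∫ o, postReal obs ν d b o * Real.log (postReal obs ν d b o)
        ∂(predictive obs ν d) - priorReal ν b * Real.log (priorReal ν b) := by
  set w := priorReal ν b
  have hw : 0 < w := (priorReal_nonneg ν b).lt_of_ne' hb
  have hx0 : ∀ o, 0 ≤ postReal obs ν d b o / w := fun o => div_nonneg (postReal_nonneg ..) hw.le
  have hi1 : Integrable (fun o => postReal obs ν d b o) (predictive obs ν d) :=
    integrable_of_bounded (measurable_postReal obs ν d b) (C := 1) fun o => by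
      rw [abs_of_nonneg (postReal_nonneg ..)]; exact postReal_le_one ..
  have hi2 : Integrable (fun o => postReal obs ν d b o * Real.log (postReal obs ν d b o))
      (predictive obs ν d) :=
    integrable_of_bounded (by fun_prop) (C := 1) fun o =>
      abs_mul_log_le_one (postReal_nonneg ..) (postReal_le_one ..)
  have hkl : ∀ o, klFun (postReal obs ν d b o / w) =
      w⁻¹ * (postReal obs ν d b o * Real.log (postReal obs ν d b o)) + 1 -
        w⁻¹ * (1 + Real.log w) * postReal obs ν d b o := fun o => by
    rw [klFun_apply]
    by_cases h : postReal obs ν d b o = 0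
    · simp [h]
    · rw [Real.log_div h hw.ne']; ring
  have hi3 : Integrable (fun o => klFun (postReal obs ν d b o / w)) (predictive obs ν d) := by
    simp only [hkl]
    exact ((hi2.const_mul _).add (integrable_const _)).sub (hi1.const_mul _)
  have hprob : IsProbabilityMeasure (mixLaw obs μ d) :=
    ⟨by rw [mixLaw_apply obs d _ MeasurableSet.univ]; simp⟩
  have hmix := mixLaw_eq_withDensity obs ν d hb hμ
  have hac : mixLaw obs μ d ≪ predictive obs ν d := by
    rw [hmix]; exact withDensity_absolutelyContinuous _ _
  refine ⟨∫ o, klFun (postReal obs ν d b o / w) ∂(predictive obs ν d),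
    integral_nonneg fun o => klFun_nonneg (hx0 o), ?_, ?_⟩
  · rw [klDiv_eq_lintegral_klFun_of_ac hac, ofReal_integral_eq_lintegral_ofReal hi3
      (ae_of_all _ fun o => klFun_nonneg (hx0 o))]
    refine lintegral_congr_ae ?_
    have := Measure.rnDeriv_withDensity (predictive obs ν d)
      (f := fun o => ENNReal.ofReal (postReal obs ν d b o / w)) (by fun_prop)
    rw [← hmix] at this
    filter_upwards [this] with o ho
    rw [ho, ENNReal.toReal_ofReal (hx0 o)]
  · simp only [hkl]
    rw [integral_sub, integral_add, integral_const_mul, integral_const_mul, integral_postReal]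
    · simp only [integral_const, probReal_univ, one_smul]
      change w * (w⁻¹ * _ + 1 - w⁻¹ * (1 + Real.log w) * w) = _
      field_simp
      ring
    · exact hi2.const_mul _
    · exact integrable_const _
    · exact (hi2.const_mul _).add (integrable_const _)
    · exact hi1.const_mul _

-- The reference model is the mean of the belief and the competitors are its conditional mixtures `μ
-- b`. By symmetry of mutual information, V is at most the prior average of the DEC objectives `X
-- b`, so it is at most one of them. That b may depend on p, which the order inf sup permits.
open Classical in
theorem le_decKLConv {f : M → D → ℝ} (hf : ∀ d, Measurable fun m => f m d) {C : ℝ}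
    (hC : ∀ m d, |f m d| ≤ C) {η : ℝ} (hη : 0 < η) {q : Measure D} [IsProbabilityMeasure q]
    (hq : ∀ d, q {d} ≠ 0) {V : ℝ} (hV : ∀ d, V ≤ decisionValue obs f η q ν d) :
    (V : EReal) ≤ decKLConv obs f η := by
  obtain ⟨μ₀, hμ₀⟩ : ∃ μ₀ : ProbabilityMeasure M,
      (μ₀ : Measure M) = (ν : Measure (M × D)).map Prod.fst :=
    ⟨⟨_, Measure.isProbabilityMeasure_map (by fun_prop)⟩, rfl⟩
  choose μ hμ using exists_conditional ν
  -- Real values of the divergences, meaningful only for b of positive prior mass; the others carry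
  -- weight zero.
  have hk : ∀ b d, ∃ k : ℝ, priorReal ν b ≠ 0 → 0 ≤ k ∧
      klDiv (mixLaw obs (μ b) d) (predictive obs ν d) = ENNReal.ofReal k ∧
      priorReal ν b * k = ∫ o, postReal obs ν d b o * Real.log (postReal obs ν d b o)
        ∂(predictive obs ν d) - priorReal ν b * Real.log (priorReal ν b) := fun b d => by
    by_cases hb : priorReal ν b = 0
    · exact ⟨0, fun h => absurd hb h⟩
    · obtain ⟨k, hk⟩ := klDiv_mixLaw obs ν d hb (hμ b)
      exact ⟨k, fun _ => hk⟩
  choose k hk using hk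
  refine le_iSup_of_le μ₀ (le_iInf fun p => ?_)
  set X : D → ℝ := fun b => (⨆ d', mixReward f (μ b) d') -
    ∑ d, (p : Measure D).real {d} * mixReward f (μ b) d -
    1 / η * ∑ d, (p : Measure D).real {d} * k b d with hX
  have hif : ∀ g : M × D → ℝ, Measurable g → (∀ x, |g x| ≤ C) →
      Integrable g (ν : Measure (M × D)) := fun g hg hgC => integrable_of_bounded hg hgC
  have hsplit : ∀ g : M × D → ℝ, Measurable g → (∀ x, |g x| ≤ C) →
      ∑ b, priorReal ν b * ∫ m, g (m, b) ∂(μ b : Measure M) = ∫ x, g x ∂(ν : Measure (M × D)) := by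
    intro g hg hgC
    have hi : ∀ b : D, Integrable (fun x : M × D => if x.2 = b then g (x.1, b) else 0)
        (ν : Measure (M × D)) := fun b => by
      refine integrable_of_bounded (C := C) ?_ fun x => ?_
      · exact Measurable.ite (measurable_snd (measurableSet_singleton b))
          (hg.comp (measurable_fst.prodMk measurable_const)) measurable_const
      · split_ifs
        · exact hgC _
        · simpa using (abs_nonneg _).trans (hgC x)
    rw [Finset.sum_congr rfl fun b _ => hμ b (fun m => g (m, b)) (hg.comp measurable_prodMk_right),
      ← integral_finsetSum _ fun b _ => hi b]
    refine integral_congr_ae (ae_of_all _ fun x => ?_)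
    simp
  have hsum : V ≤ ∑ b, priorReal ν b * X b := by
    have hsup : ∀ b, mixReward f (μ b) b ≤ ⨆ d', mixReward f (μ b) d' := fun b =>
      le_ciSup (Set.finite_range _).bddAbove b
    have hkl : ∀ d, ∑ b, priorReal ν b * k b d =
        negEntropy obs ν d - ∑ b, priorReal ν b * Real.log (priorReal ν b) := fun d => by
      rw [negEntropy, integral_finsetSum, ← Finset.sum_sub_distrib]
      · refine Finset.sum_congr rfl fun b _ => ?_
        by_cases hb : priorReal ν b = 0
        · rw [hb, integral_congr_ae (g := fun _ => (0 : ℝ))]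
          · simp
          · filter_upwards [postReal_ae_eq_zero obs ν d hb] with o ho
            simp [ho]
        · exact (hk b d hb).2.2
      · exact fun b _ => integrable_of_bounded (by fun_prop) (C := 1) fun o =>
          abs_mul_log_le_one (postReal_nonneg ..) (postReal_le_one ..)
    have hm : Measurable fun x : M × D => f x.1 x.2 := measurable_reward hf
    have h1 : ∑ b, priorReal ν b * mixReward f (μ b) b = ∫ x, f x.1 x.2 ∂(ν : Measure (M × D)) :=
      hsplit (fun x => f x.1 x.2) hm fun x => hC _ _
    have h2 : ∀ d, ∑ b, priorReal ν b * mixReward f (μ b) d =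
        ∫ x, f x.1 d ∂(ν : Measure (M × D)) := fun d =>
      hsplit (fun x => f x.1 d) ((hf d).comp measurable_fst) fun x => hC _ _
    calc V = ∑ d, (p : Measure D).real {d} * V := by
          rw [← Finset.sum_mul, sum_real_singleton_eq_one, one_mul]
      _ ≤ ∑ d, (p : Measure D).real {d} * (∑ b, priorReal ν b * mixReward f (μ b) b -
          ∑ b, priorReal ν b * mixReward f (μ b) d - 1 / η * ∑ b, priorReal ν b * k b d) := by
        refine Finset.sum_le_sum fun d _ => mul_le_mul_of_nonneg_left ?_ measureReal_nonneg
        refine (hV d).trans ?_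
        have h3 : decisionRegret f ν d = ∫ x, f x.1 x.2 ∂(ν : Measure (M × D)) -
            ∫ x, f x.1 d ∂(ν : Measure (M × D)) :=
          integral_sub (hif _ hm fun x => hC _ _)
            (hif _ ((hf d).comp measurable_fst) fun x => hC _ _)
        rw [h1, h2, hkl, decisionValue, h3]
        refine sub_le_sub_left (mul_le_mul_of_nonneg_left ?_ (by positivity)) _
        exact decisionKL_prior_le obs (fun b h => absurd h (real_singleton_ne_zero hq b)) d
      _ = ∑ b, priorReal ν b * (mixReward f (μ b) b -
          ∑ d, (p : Measure D).real {d} * mixReward f (μ b) d -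
          1 / η * ∑ d, (p : Measure D).real {d} * k b d) := by
        simp only [mul_sub, Finset.sum_sub_distrib, Finset.mul_sum]
        congr 1
        · congr 1
          · rw [Finset.sum_comm]
            refine Finset.sum_congr rfl fun b _ => ?_
            rw [← Finset.sum_mul, sum_real_singleton_eq_one, one_mul]
          rw [Finset.sum_comm]
          exact Finset.sum_congr rfl fun _ _ => Finset.sum_congr rfl fun _ _ => by ring
        · rw [Finset.sum_comm]
          exact Finset.sum_congr rfl fun _ _ => Finset.sum_congr rfl fun _ _ => by ring
      _ ≤ _ := Finset.sum_le_sum fun b _ => mul_le_mul_of_nonneg_left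
        (sub_le_sub_right (sub_le_sub_right (hsup b) _) _) (priorReal_nonneg ν b)
  -- The averaging argument must return a b of positive prior mass, since only there is `k b` the
  -- true divergence.
  obtain ⟨b, hb, hVb⟩ : ∃ b, priorReal ν b ≠ 0 ∧ V ≤ X b := by
    by_contra! hcon
    have hle : ∀ b ∈ Finset.univ, priorReal ν b * X b ≤ priorReal ν b * V := fun b _ => by
      by_cases hb : priorReal ν b = 0
      · simp [hb]
      · exact mul_le_mul_of_nonneg_left (hcon b hb).le (priorReal_nonneg ν b)
    obtain ⟨b, hb⟩ : ∃ b, priorReal ν b ≠ 0 := by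
      by_contra! h
      have := sum_priorReal ν
      simp [h] at this
    have := Finset.sum_lt_sum hle ⟨b, Finset.mem_univ b, mul_lt_mul_of_pos_left (hcon b hb)
      ((priorReal_nonneg ν b).lt_of_ne' hb)⟩
    rw [← Finset.sum_mul, sum_priorReal, one_mul] at this
    linarith
  refine le_iSup_of_le (μ b) ?_
  have hlk : ∫⁻ d, klDiv (mixLaw obs (μ b) d) (mixLaw obs μ₀ d) ∂(p : Measure D) =
      ENNReal.ofReal (∑ d, (p : Measure D).real {d} * k b d) := by
    rw [lintegral_fintype, ENNReal.ofReal_sum_of_nonneg fun d _ =>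
      mul_nonneg measureReal_nonneg (hk b d hb).1]
    refine Finset.sum_congr rfl fun d _ => ?_
    rw [mixLaw_map_fst obs ν d hμ₀, (hk b d hb).2.1, ENNReal.ofReal_mul measureReal_nonneg,
      ofReal_measureReal, mul_comm]
  rw [hlk, EReal.coe_ennreal_ofReal, max_eq_left (Finset.sum_nonneg fun d _ =>
    mul_nonneg measureReal_nonneg (hk b d hb).1), ← EReal.coe_mul, ← EReal.coe_sub,
    EReal.coe_le_coe_iff, integral_fintype (Integrable.of_finite)]
  exact hVb

end DEC

open Filter Topology

/-! ### The first-order optimality condition -/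

/-- The logarithmic loss `-log x`, with value `∞` at `0`. -/
noncomputable def logLoss (x : ℝ) : ℝ≥0∞ := if x = 0 then ⊤ else ENNReal.ofReal (-Real.log x)

theorem measurable_logLoss : Measurable logLoss :=
  Measurable.ite (measurableSet_singleton 0) measurable_const
    (Real.measurable_log.neg.ennreal_ofReal)

/-- The value ∞ at 0 makes the log loss continuous from the right there, so the Fatou limit keeps
the loss where the posterior vanishes. -/
theorem tendsto_ofReal_neg_log {y : ℕ → ℝ} {x : ℝ} (hy : ∀ n, 0 < y n)
    (h : Tendsto y atTop (𝓝 x)) :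
    Tendsto (fun n => ENNReal.ofReal (-Real.log (y n))) atTop (𝓝 (logLoss x)) := by
  unfold logLoss
  split_ifs with hx
  · subst hx
    refine ENNReal.tendsto_ofReal_nhds_top.2 ?_
    exact tendsto_neg_atBot_atTop.comp (Real.tendsto_log_nhdsGT_zero.comp
      (tendsto_nhdsWithin_iff.2 ⟨h, Eventually.of_forall hy⟩))
  · exact ENNReal.tendsto_ofReal ((h.log hx).neg)

/-! ### Mixing in an alternative model at a single observation -/

section Pointwise

/-- The posterior probability of a decision `a` after mixing in, with weight `ε`, an alternative
under which `a` is optimal, when `x` is the original posterior probability and `r` the likelihood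
ratio of the alternative. -/
noncomputable def mixedPosterior (ε x r : ℝ) : ℝ := ((1 - ε) * x + ε * r) / ((1 - ε) + ε * r)

variable {ε x r : ℝ}

theorem mixedPosterior_nonneg (h0 : 0 < ε) (h1 : ε < 1) (hx0 : 0 ≤ x) (hr : 0 ≤ r) :
    0 ≤ mixedPosterior ε x r := by
  have := sub_pos.2 h1
  unfold mixedPosterior; positivity

theorem mixedPosterior_le_one (h0 : 0 < ε) (h1 : ε < 1) (hx1 : x ≤ 1) (hr : 0 ≤ r) :
    mixedPosterior ε x r ≤ 1 := by
  have := sub_pos.2 h1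
  refine div_le_one_of_le₀ ?_ (by positivity)
  nlinarith

theorem mixedPosterior_pos (h0 : 0 < ε) (h1 : ε < 1) (hx0 : 0 ≤ x) (hr : 0 < r) :
    0 < mixedPosterior ε x r := by
  have := sub_pos.2 h1
  unfold mixedPosterior; positivity

theorem mul_neg_log_mixedPosterior_nonneg (h0 : 0 < ε) (h1 : ε < 1) (hx0 : 0 ≤ x) (hx1 : x ≤ 1)
    (hr : 0 ≤ r) : 0 ≤ r * -Real.log (mixedPosterior ε x r) :=
  mul_nonneg hr (neg_nonneg.2 (Real.log_nonpos (mixedPosterior_nonneg h0 h1 hx0 hr)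
    (mixedPosterior_le_one h0 h1 hx1 hr)))

/-- The mixed posterior is at least ε r / ((1-ε) + ε r), and -log y ≤ 1/y. The bound blows up as ε →
0 and serves only for integrability at fixed ε. -/
theorem mul_neg_log_mixedPosterior_le (h0 : 0 < ε) (h1 : ε < 1) (hx0 : 0 ≤ x) (hr : 0 ≤ r) :
    r * -Real.log (mixedPosterior ε x r) ≤ 1 / ε * ((1 - ε) + ε * r) := by
  have h1' := sub_pos.2 h1
  rcases hr.eq_or_lt with rfl | hr
  · rw [zero_mul]; positivity
  have hpos := mixedPosterior_pos h0 h1 hx0 hr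
  have hlog := Real.log_le_sub_one_of_pos (inv_pos.2 hpos)
  rw [Real.log_inv] at hlog
  have hinv : (mixedPosterior ε x r)⁻¹ ≤ ((1 - ε) + ε * r) / (ε * r) := by
    rw [mixedPosterior, inv_div]
    have : 0 ≤ (1 - ε) * x := by positivity
    gcongr
    linarith
  calc r * -Real.log (mixedPosterior ε x r) ≤ r * (((1 - ε) + ε * r) / (ε * r)) := by
        refine mul_le_mul_of_nonneg_left ?_ hr.le
        linarith
    _ = _ := by field_simp

/-- The shift by 2 keeps the weight strictly between 0 and 1, including at n = 0. -/
theorem tendsto_mixedPosterior (x r : ℝ) :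
    Tendsto (fun n : ℕ => mixedPosterior (1 / (n + 2)) x r) atTop (𝓝 x) := by
  have h : Tendsto (fun n : ℕ => (1 : ℝ) / (n + 2)) atTop (𝓝 0) := by
    have := (tendsto_one_div_add_atTop_nhds_zero_nat (𝕜 := ℝ)).comp (tendsto_add_atTop_nat 1)
    refine this.congr fun n => ?_
    simp only [Function.comp_apply, Nat.cast_add, Nat.cast_one]
    ring
  have hc : ContinuousAt (fun ε : ℝ => mixedPosterior ε x r) 0 := by
    unfold mixedPosterior
    refine ContinuousAt.div (by fun_prop) (by fun_prop) (by norm_num)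
  have := hc.tendsto.comp h
  simpa [mixedPosterior, Function.comp_def] using this

variable {D O : Type*} [Fintype D] [DecidableEq D]

/-- The left side is s ∑ z b * `dualTest u b o`, where s is the density of the mixed predictive law
relative to the old one and z the mixed posterior. Duality bounds it by s ∑ z log z. Gibbs'
inequality then replaces log z by log x in the part of weight 1-ε, leaving log z only at a. -/
theorem sum_dualTest_le {x : D → ℝ} (hx0 : ∀ b, 0 ≤ x b) (hx1 : ∑ b, x b = 1) (h0 : 0 < ε)
    (h1 : ε < 1) (hr : 0 ≤ r) (a : D) (u : D → O → ℝ) (o : O) :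
    (1 - ε) * ∑ b, x b * dualTest u b o + ε * (r * dualTest u a o) ≤
      (1 - ε) * ∑ b, x b * Real.log (x b) - ε * (r * -Real.log (mixedPosterior ε (x a) r)) := by
  have h1' := sub_pos.2 h1
  set s := (1 - ε) + ε * r with hs
  have hspos : 0 < s := by positivity
  set z : D → ℝ := fun b => ((1 - ε) * x b + if b = a then ε * r else 0) / s with hz
  have hz0 : ∀ b, 0 ≤ z b := fun b => by
    refine div_nonneg (add_nonneg (mul_nonneg h1'.le (hx0 b)) ?_) hspos.le
    split_ifs <;> positivity
  have hsplit : ∀ c : D → ℝ, s * ∑ b, z b * c b = (1 - ε) * ∑ b, x b * c b + ε * (r * c a) := by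
    intro c
    have : ∀ b, s * (z b * c b) = (1 - ε) * (x b * c b) + if b = a then ε * r * c b else 0 :=
      fun b => by
        simp only [hz]
        rw [← mul_assoc, mul_div_cancel₀ _ hspos.ne']
        split_ifs <;> ring
    rw [Finset.mul_sum, Finset.sum_congr rfl fun b _ => this b, Finset.sum_add_distrib,
      Finset.mul_sum]
    simp [mul_assoc]
  have hz1 : ∑ b, z b = 1 := by
    have := hsplit fun _ => 1
    simp only [mul_one, hx1] at this
    rw [← hs] at this
    exact mul_left_cancel₀ hspos.ne' (by rw [this, mul_one])
  have hza : z a = mixedPosterior ε (x a) r := by simp [hz, mixedPosterior, hs]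
  have hgibbs : ∑ b, x b * Real.log (z b) ≤ ∑ b, x b * Real.log (x b) := by
    have key : ∀ b, x b * Real.log (z b) + x b - z b ≤ x b * Real.log (x b) := fun b => by
      rcases (hz0 b).eq_or_lt with h | h
      · have hn : (1 - ε) * x b + (if b = a then ε * r else 0) = 0 := by
          rcases div_eq_zero_iff.1 h.symm with h | h
          · exact h
          · exact absurd h hspos.ne'
        have hxb : x b = 0 := by
          have h2 : (0 : ℝ) ≤ if b = a then ε * r else 0 := by split_ifs <;> positivity
          have h3 := mul_nonneg h1'.le (hx0 b)
          have h4 : (1 - ε) * x b = 0 := by linarith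
          exact (mul_eq_zero.1 h4).resolve_left h1'.ne'
        simp [hxb, ← h]
      · have := mul_add_sub_exp_le_mul_log (hx0 b) (Real.log (z b))
        rwa [Real.exp_log h] at this
    have := Finset.sum_le_sum fun b (_ : b ∈ Finset.univ) => key b
    rw [Finset.sum_sub_distrib, Finset.sum_add_distrib] at this
    linarith
  have hdual : ∑ b, z b * dualTest u b o ≤ ∑ b, z b * Real.log (z b) := by
    rw [sum_mul_dualTest hz1]
    exact Finset.sum_le_sum fun b _ => mul_add_sub_exp_le_mul_log (hz0 b) _
  rw [← hsplit fun b => dualTest u b o]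
  refine (mul_le_mul_of_nonneg_left hdual hspos.le).trans ?_
  rw [hsplit fun b => Real.log (z b), hza]
  have := mul_le_mul_of_nonneg_left hgibbs h1'.le
  linarith

end Pointwise

/-! ### Perturbing the maximizing belief towards a point mass -/

section Optimality

variable {M D O : Type*} [MeasurableSpace M]
  [Fintype D] [Nonempty D] [MeasurableSpace D] [MeasurableSingletonClass D]
  [MeasurableSpace O]
  (obs : Kernel (M × D) O) [IsMarkovKernel obs] {ν : ProbabilityMeasure (M × D)} {m : M} {d a : D}

/-- The likelihood ratio of the model `m` and the predictive law. -/
noncomputable def likelihoodRatio (ν : ProbabilityMeasure (M × D)) (m : M) (d : D) (o : O) : ℝ :=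
  ((obs (m, d)).rnDeriv (predictive obs ν d) o).toReal

theorem likelihoodRatio_nonneg (o : O) : 0 ≤ likelihoodRatio obs ν m d o := ENNReal.toReal_nonneg

@[fun_prop]
theorem measurable_likelihoodRatio : Measurable (likelihoodRatio obs ν m d) :=
  (Measure.measurable_rnDeriv _ _).ennreal_toReal

theorem integrable_likelihoodRatio :
    Integrable (likelihoodRatio obs ν m d) (predictive obs ν d) :=
  Measure.integrable_toReal_rnDeriv

/-- The log loss of the mixed posterior, weighted by the likelihood ratio. -/
noncomputable def mixedLoss (ν : ProbabilityMeasure (M × D)) (m : M) (a : D) (ε : ℝ) (d : D)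
    (o : O) : ℝ :=
  likelihoodRatio obs ν m d o *
    -Real.log (mixedPosterior ε (postReal obs ν d a o) (likelihoodRatio obs ν m d o))

theorem measurable_mixedPosterior (ε : ℝ) : Measurable fun o =>
    mixedPosterior ε (postReal obs ν d a o) (likelihoodRatio obs ν m d o) := by
  unfold mixedPosterior; fun_prop

variable {ε : ℝ}

theorem mixedLoss_nonneg (h0 : 0 < ε) (h1 : ε < 1) (o : O) : 0 ≤ mixedLoss obs ν m a ε d o :=
  mul_neg_log_mixedPosterior_nonneg h0 h1 (postReal_nonneg ..) (postReal_le_one ..)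
    (likelihoodRatio_nonneg ..)

theorem integrable_mixedLoss (h0 : 0 < ε) (h1 : ε < 1) :
    Integrable (mixedLoss obs ν m a ε d) (predictive obs ν d) := by
  refine Integrable.mono' (((integrable_const (1 - ε)).add
    ((integrable_likelihoodRatio obs (ν := ν) (m := m) (d := d)).const_mul ε)).const_mul (1 / ε))
    ?_ (ae_of_all _ fun o => ?_)
  · exact ((measurable_likelihoodRatio obs).mul
      (measurable_mixedPosterior obs ε).log.neg).aestronglyMeasurable
  · rw [Real.norm_eq_abs, abs_of_nonneg (mixedLoss_nonneg obs h0 h1 o)]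
    exact mul_neg_log_mixedPosterior_le h0 h1 (postReal_nonneg ..) (likelihoodRatio_nonneg ..)

/-- The likelihood ratio in `mixedLoss` is the change of measure from the predictive law to the true
observation law. -/
theorem lintegral_mixedPosterior (h0 : 0 < ε) (h1 : ε < 1)
    (hac : obs (m, d) ≪ predictive obs ν d) :
    ∫⁻ o, ENNReal.ofReal (-Real.log (mixedPosterior ε (postReal obs ν d a o)
        (likelihoodRatio obs ν m d o))) ∂obs (m, d) =
      ENNReal.ofReal (∫ o, mixedLoss obs ν m a ε d o ∂(predictive obs ν d)) := by
  rw [ofReal_integral_eq_lintegral_ofReal (integrable_mixedLoss obs h0 h1)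
    (ae_of_all _ (mixedLoss_nonneg obs h0 h1)), ← lintegral_rnDeriv_mul hac
    (f := fun o => ENNReal.ofReal (-Real.log (mixedPosterior ε (postReal obs ν d a o)
      (likelihoodRatio obs ν m d o))))
    (measurable_mixedPosterior obs ε).log.neg.ennreal_ofReal.aemeasurable]
  refine lintegral_congr_ae ?_
  filter_upwards [Measure.rnDeriv_lt_top (obs (m, d)) (predictive obs ν d)] with o ho
  rw [mixedLoss, ENNReal.ofReal_mul (likelihoodRatio_nonneg ..), likelihoodRatio,
    ENNReal.ofReal_toReal ho.ne]

variable [MetricSpace O] [BorelSpace O]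

/-- The negative entropy after mixing in, with weight `ε`, the model `m` with optimal
decision `a`. -/
theorem negEntropy_mix_le (h0 : 0 < ε) (h1 : ε < 1) (hac : obs (m, d) ≪ predictive obs ν d)
    {ν' : ProbabilityMeasure (M × D)}
    (hν' : ∀ g : M × D → ℝ, Measurable g → ∀ C, (∀ x, |g x| ≤ C) →
      ∫ x, g x ∂(ν' : Measure (M × D)) = (1 - ε) * ∫ x, g x ∂(ν : Measure (M × D)) +
        ε * ∫ x, g x ∂(Measure.dirac (m, a))) :
    negEntropy obs ν' d ≤ (1 - ε) * negEntropy obs ν d -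
      ε * ∫ o, mixedLoss obs ν m a ε d o ∂(predictive obs ν d) := by
  classical
  refine le_of_forall_pos_le_add fun τ hτ => ?_
  -- A nearly optimal test function for the perturbed belief replaces the computation of its
  -- posterior; only integrals against ν and the point mass are needed.
  obtain ⟨u, hu⟩ := exists_negEntropy_le obs ν' d hτ
  have hm : ∀ b, Measurable (fun o => u b o) := fun b => (u b).continuous.measurable
  have hb := boundedContinuous_bound u
  have hd := abs_dualTest_le hb
  have hdm := measurable_dualTest hm
  rw [hν' _ (measurable_integral_obs obs d hdm) _ (abs_integral_obs_le obs d hd),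
    integral_dirac' _ _ (measurable_integral_obs obs d hdm).stronglyMeasurable,
    integral_integral_obs obs ν d hdm hd] at hu
  have hrn : ∫ o, dualTest (fun b o => u b o) a o ∂obs (m, d) =
      ∫ o, likelihoodRatio obs ν m d o * dualTest (fun b o => u b o) a o
        ∂(predictive obs ν d) := (integral_rnDeriv_smul hac).symm
  have hi1 := integrable_sum_postReal_mul obs ν d hdm hd
  have hi2 : Integrable (fun o => likelihoodRatio obs ν m d o * dualTest (fun b o => u b o) a o)
      (predictive obs ν d) :=
    (integrable_likelihoodRatio obs).mul_bdd (hdm a).aestronglyMeasurable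
      (ae_of_all _ fun o => hd a o)
  have hi3 := integrable_sum_postReal_log obs ν d
  have hi4 := integrable_mixedLoss obs (ν := ν) (m := m) (a := a) (d := d) h0 h1
  refine hu.trans (add_le_add_left ?_ τ)
  simp only
  rw [hrn, ← integral_const_mul, ← integral_const_mul, ← integral_add (hi1.const_mul _)
    (hi2.const_mul _), negEntropy, ← integral_const_mul, ← integral_const_mul,
    ← integral_sub (hi3.const_mul _) (hi4.const_mul _)]
  exact integral_mono ((hi1.const_mul _).add (hi2.const_mul _))
    ((hi3.const_mul _).sub (hi4.const_mul _)) fun o =>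
    sum_dualTest_le (fun b => postReal_nonneg ..) (sum_postReal obs ν d o) h0 h1
      (likelihoodRatio_nonneg ..) a _ o

variable {f : M → D → ℝ} (hf : ∀ d, Measurable fun m => f m d) {C : ℝ}
  (hC : ∀ m d, |f m d| ≤ C) {η : ℝ} (hη : 0 < η) {p q : Measure D} [IsProbabilityMeasure p]
  (hmax : ∀ ν', ∑ d, p.real {d} * decisionValue obs f η q ν' d ≤
    ∑ d, p.real {d} * decisionValue obs f η q ν d)
  (hac : ∀ d, p {d} ≠ 0 → obs (m, d) ≪ predictive obs ν d)

include hf hC hη hmax hac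

/-- Optimality of `ν` against the mixtures with a single model. -/
theorem sum_mixedLoss_le (h0 : 0 < ε) (h1 : ε < 1) :
    ∑ d, p.real {d} * ∫ o, mixedLoss obs ν m a ε d o ∂(predictive obs ν d) ≤
      η * (∑ d, p.real {d} * decisionValue obs f η q ν d - (f m a - ∑ d, p.real {d} * f m d)) -
        Real.log (q.real {a}) := by
  obtain ⟨δ, hδ⟩ : ∃ δ : ProbabilityMeasure (M × D), (δ : Measure (M × D)) = Measure.dirac (m, a) :=
    ⟨⟨Measure.dirac (m, a), Measure.dirac.isProbabilityMeasure⟩, rfl⟩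
  obtain ⟨ν', hν'⟩ := exists_convexCombination ν δ h0.le h1.le
  have hη' : 0 < 1 / η := by positivity
  have hR : ∀ d, decisionRegret f ν' d = (1 - ε) * decisionRegret f ν d + ε * (f m a - f m d) :=
    fun d => by
      rw [decisionRegret_convexCombination hf hC hν' d]
      congr 2
      rw [decisionRegret, hδ]
      exact integral_dirac' _ _
        ((measurable_reward hf).sub ((hf d).comp measurable_fst)).stronglyMeasurable
  have hL : ∑ b, priorReal ν' b * Real.log (q.real {b}) =
      (1 - ε) * ∑ b, priorReal ν b * Real.log (q.real {b}) + ε * Real.log (q.real {a}) := by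
    rw [sum_prior_convexCombination _ hν']
    congr 2
    rw [← integral_snd_eq_sum, hδ]
    exact integral_dirac' _ _
      ((Measurable.of_discrete (f := fun b : D => Real.log (q.real {b}))).comp
        measurable_snd).stronglyMeasurable
  set G : D → ℝ := fun d => ∫ o, mixedLoss obs ν m a ε d o ∂(predictive obs ν d)
  -- Up to the factor ε the perturbed value contains (1-ε) times the old one, so maximality of ν
  -- divides by ε. Decisions with p-mass zero, for which absolute continuity is not assumed,
  -- contribute nothing.
  have hstep : ∀ d, p.real {d} * ((1 - ε) * decisionValue obs f η q ν d +
      ε * ((f m a - f m d) + 1 / η * (Real.log (q.real {a}) + G d))) ≤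
      p.real {d} * decisionValue obs f η q ν' d := fun d => by
    by_cases hd : p {d} = 0
    · simp [Measure.real, hd]
    refine mul_le_mul_of_nonneg_left ?_ measureReal_nonneg
    have hG := mul_le_mul_of_nonneg_left (negEntropy_mix_le obs h0 h1 (hac d hd) (hδ ▸ hν')) hη'.le
    rw [decisionValue, decisionValue, decisionKL, decisionKL, hR, hL]
    simp only [G]
    linarith
  have hsum := (Finset.sum_le_sum fun d (_ : d ∈ Finset.univ) => hstep d).trans (hmax ν')
  have hexp : ∑ d, p.real {d} * ((1 - ε) * decisionValue obs f η q ν d +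
      ε * ((f m a - f m d) + 1 / η * (Real.log (q.real {a}) + G d))) =
      (1 - ε) * ∑ d, p.real {d} * decisionValue obs f η q ν d +
        ε * ((f m a - ∑ d, p.real {d} * f m d) +
          1 / η * (Real.log (q.real {a}) + ∑ d, p.real {d} * G d)) := by
    have e : ∀ d, p.real {d} * ((1 - ε) * decisionValue obs f η q ν d +
        ε * ((f m a - f m d) + 1 / η * (Real.log (q.real {a}) + G d))) =
        (1 - ε) * (p.real {d} * decisionValue obs f η q ν d) +
          ε * (p.real {d} * (f m a + 1 / η * Real.log (q.real {a})) - p.real {d} * f m d +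
            1 / η * (p.real {d} * G d)) := fun d => by ring
    rw [Finset.sum_congr rfl fun d _ => e d]
    simp only [Finset.sum_add_distrib, Finset.sum_sub_distrib, ← Finset.mul_sum, ← Finset.sum_mul,
      sum_real_singleton_eq_one]
    ring
  rw [hexp] at hsum
  set V := ∑ d, p.real {d} * decisionValue obs f η q ν d
  have h2 : (f m a - ∑ d, p.real {d} * f m d) +
      1 / η * (Real.log (q.real {a}) + ∑ d, p.real {d} * G d) ≤ V := by
    have : ε * ((f m a - ∑ d, p.real {d} * f m d) +
      1 / η * (Real.log (q.real {a}) + ∑ d, p.real {d} * G d)) ≤ ε * V := by linarith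
    exact le_of_mul_le_mul_left this h0
  have h3 := mul_le_mul_of_nonneg_left h2 hη.le
  rw [mul_add, ← mul_assoc, mul_one_div_cancel hη.ne'] at h3
  linarith

/-- The expected log loss of the posterior at the decision `a`, when the model is `m`, is
controlled by the minimax value. -/
theorem lintegral_logLoss_posterior_le (a : D) :
    0 ≤ η * (∑ d, p.real {d} * decisionValue obs f η q ν d - (f m a - ∑ d, p.real {d} * f m d)) -
        Real.log (q.real {a}) ∧
    ∫⁻ d, ∫⁻ o, logLoss (postReal obs ν d a o) ∂obs (m, d) ∂p ≤
      ENNReal.ofReal (η * (∑ d, p.real {d} * decisionValue obs f η q ν d -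
        (f m a - ∑ d, p.real {d} * f m d)) - Real.log (q.real {a})) := by
  have hε0 : ∀ n : ℕ, (0 : ℝ) < 1 / (n + 2) := fun n => by positivity
  have hε1 : ∀ n : ℕ, (1 : ℝ) / (n + 2) < 1 := fun n => by
    rw [div_lt_one (by positivity)]
    have : (0 : ℝ) ≤ n := n.cast_nonneg
    linarith
  have hbound := fun n => sum_mixedLoss_le (a := a) obs hf hC hη hmax hac (hε0 n) (hε1 n)
  refine ⟨(Finset.sum_nonneg fun d _ => mul_nonneg measureReal_nonneg
    (integral_nonneg (mixedLoss_nonneg obs (hε0 0) (hε1 0)))).trans (hbound 0), ?_⟩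
  set J : ℕ → D → ℝ≥0∞ := fun n d => ∫⁻ o, ENNReal.ofReal (-Real.log (mixedPosterior (1 / (n + 2))
    (postReal obs ν d a o) (likelihoodRatio obs ν m d o))) ∂obs (m, d) with hJ
  have hJle : ∀ n, ∫⁻ d, J n d ∂p ≤ ENNReal.ofReal (η * (∑ d, p.real {d} *
      decisionValue obs f η q ν d - (f m a - ∑ d, p.real {d} * f m d)) -
        Real.log (q.real {a})) := fun n => by
    refine le_trans (le_of_eq ?_) (ENNReal.ofReal_le_ofReal (hbound n))
    rw [lintegral_fintype, ENNReal.ofReal_sum_of_nonneg fun d _ => mul_nonneg measureReal_nonneg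
      (integral_nonneg (mixedLoss_nonneg obs (hε0 n) (hε1 n)))]
    refine Finset.sum_congr rfl fun d _ => ?_
    by_cases hd : p {d} = 0
    · simp [Measure.real, hd]
    · rw [hJ]
      beta_reduce
      rw [lintegral_mixedPosterior obs (hε0 n) (hε1 n) (hac d hd),
        ENNReal.ofReal_mul measureReal_nonneg, ofReal_measureReal, mul_comm]
  -- Under the true law the likelihood ratio is almost surely positive, which keeps each mixed
  -- posterior positive while it converges to the posterior.
  have hfatou : ∀ᵐ d ∂p, ∫⁻ o, logLoss (postReal obs ν d a o) ∂obs (m, d) ≤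
      liminf (fun n => J n d) atTop := by
    rw [ae_iff_of_countable]
    intro d hd
    refine le_trans (lintegral_mono_ae ?_) (lintegral_liminf_le fun n =>
      (measurable_mixedPosterior obs _).log.neg.ennreal_ofReal)
    filter_upwards [Measure.rnDeriv_pos (hac d hd),
      (hac d hd).ae_le (Measure.rnDeriv_lt_top (obs (m, d)) (predictive obs ν d))] with o ho1 ho2
    have hpos : 0 < likelihoodRatio obs ν m d o := ENNReal.toReal_pos ho1.ne' ho2.ne
    exact (tendsto_ofReal_neg_log (fun n => mixedPosterior_pos (hε0 n) (hε1 n)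
      (postReal_nonneg obs ν d a o) hpos) (tendsto_mixedPosterior _ _)).liminf_eq.ge
  calc _ ≤ ∫⁻ d, liminf (fun n => J n d) atTop ∂p := lintegral_mono_ae hfatou
    _ ≤ liminf (fun n => ∫⁻ d, J n d ∂p) atTop := lintegral_liminf_le fun n => .of_discrete
    _ ≤ liminf (fun _ : ℕ => _) atTop := liminf_le_liminf (Eventually.of_forall hJle)
    _ = _ := liminf_const _

end Optimality

open Filter

/-! ### The law of the history -/

section History

variable {M D O : Type*} [MeasurableSpace M] [MeasurableSpace D] [MeasurableSpace O]
  (obs : Kernel (M × D) O) [IsMarkovKernel obs] (p : ∀ t, Kernel (History D O t) D)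
  [∀ t, IsMarkovKernel (p t)] {env : ∀ t, History D O t → M} (henv : ∀ t, Measurable (env t))

instance isProbabilityMeasure_historyLaw : ∀ t, IsProbabilityMeasure (historyLaw obs p env henv t)
  | 0 => Measure.dirac.isProbabilityMeasure
  | t + 1 => by
    have := isProbabilityMeasure_historyLaw t
    change @IsProbabilityMeasure (History D O t × (D × O)) _ (historyLaw obs p env henv t ⊗ₘ
      (p t ⊗ₖ obs.comap (fun x : History D O t × D => (env t x.1, x.2)) _))
    infer_instance

theorem measurable_env_prod {env : ∀ t, History D O t → M} (henv : ∀ t, Measurable (env t))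
    (t : ℕ) :
    Measurable fun x : History D O t × D => (env t x.1, x.2) :=
  ((henv t).comp measurable_fst).prodMk measurable_snd

theorem lintegral_historyLaw_succ (t : ℕ) {g : History D O (t + 1) → ℝ≥0∞} (hg : Measurable g) :
    ∫⁻ h, g h ∂(historyLaw obs p env henv (t + 1)) =
      ∫⁻ h, ∫⁻ d, ∫⁻ o, g (h, (d, o)) ∂obs (env t h, d) ∂(p t h)
        ∂(historyLaw obs p env henv t) := by
  have hg' : Measurable fun x : History D O t × (D × O) => g x := hg
  refine (Measure.lintegral_compProd (μ := historyLaw obs p env henv t)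
    (κ := p t ⊗ₖ obs.comap (fun x : History D O t × D => (env t x.1, x.2))
      (measurable_env_prod henv t)) hg').trans ?_
  refine lintegral_congr fun h => ?_
  exact Kernel.lintegral_compProd (p t) (obs.comap (fun x : History D O t × D => (env t x.1, x.2))
    (measurable_env_prod henv t)) h (f := fun b => g ((h, b) : History D O t × (D × O)))
    (hg'.comp measurable_prodMk_left)

theorem integral_historyLaw_succ (t : ℕ) {g : History D O t × D → ℝ} (hg : Measurable g) {C : ℝ}
    (hC : ∀ x, |g x| ≤ C) :
    ∫ h : History D O t × (D × O), g (h.1, h.2.1) ∂(historyLaw obs p env henv (t + 1)) =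
      ∫ h, ∫ d, g (h, d) ∂(p t h) ∂(historyLaw obs p env henv t) := by
  have hg' : Measurable fun x : History D O t × (D × O) => g (x.1, x.2.1) :=
    hg.comp (measurable_fst.prodMk measurable_snd.fst)
  refine (Measure.integral_compProd (μ := historyLaw obs p env henv t)
    (κ := p t ⊗ₖ obs.comap (fun x : History D O t × D => (env t x.1, x.2))
      (measurable_env_prod henv t)) (integrable_of_bounded hg' fun x => hC _)).trans ?_
  refine integral_congr_ae (ae_of_all _ fun h => ?_)
  beta_reduce
  rw [integral_compProd]
  · simp
  · exact integrable_of_bounded (hg'.comp measurable_prodMk_left) fun x => hC _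

end History

/-! ### Cumulative regret along the history -/

section Regret

variable {M D O : Type*} [MeasurableSpace M]
  [Fintype D] [Nonempty D] [MeasurableSpace D] [MeasurableSingletonClass D]
  [MeasurableSpace O]
  (obs : Kernel (M × D) O) [IsMarkovKernel obs] (p : ∀ t, Kernel (History D O t) D)
  [∀ t, IsMarkovKernel (p t)] {env : ∀ t, History D O t → M} (henv : ∀ t, Measurable (env t))
  {f : M → D → ℝ} (hf : ∀ d, Measurable fun m => f m d) {C : ℝ} (hC : ∀ m d, |f m d| ≤ C)

include hf in
theorem measurable_roundRegret (henv : ∀ t, Measurable (env t)) (a : D) (t : ℕ) :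
    Measurable fun x : History D O t × D => f (env t x.1) a - f (env t x.1) x.2 :=
  ((hf a).comp ((henv t).comp measurable_fst)).sub
    ((measurable_reward hf).comp (measurable_env_prod henv t))

include hf henv in
theorem measurable_cumulativeRegret (a : D) :
    ∀ t, Measurable (cumulativeRegret (O := O) f env a t)
  | 0 => measurable_const
  | t + 1 => by
    have h1 : Measurable fun h : History D O t × (D × O) => cumulativeRegret f env a t h.1 :=
      (measurable_cumulativeRegret a t).comp measurable_fst
    exact h1.add ((measurable_roundRegret hf henv a t).comp
      (measurable_fst.prodMk measurable_snd.fst))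

include hC in
theorem abs_cumulativeRegret_le (a : D) :
    ∀ t (h : History D O t), |cumulativeRegret f env a t h| ≤ t * (C + C)
  | 0, _ => by simp [cumulativeRegret]
  | t + 1, h => by
    have h1 := abs_cumulativeRegret_le a t h.1
    have h2 : |f (env t h.1) a - f (env t h.1) h.2.1| ≤ C + C :=
      (abs_sub _ _).trans (add_le_add (hC _ _) (hC _ _))
    change |cumulativeRegret f env a t h.1 + (f (env t h.1) a - f (env t h.1) h.2.1)| ≤ _
    push_cast
    linarith [abs_add_le (cumulativeRegret f env a t h.1)
      (f (env t h.1) a - f (env t h.1) h.2.1)]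

/-- The expected regret of a round given the history. -/
noncomputable def roundRegret (f : M → D → ℝ) (p : ∀ t, Kernel (History D O t) D)
    (env : ∀ t, History D O t → M) (a : D) (t : ℕ) (h : History D O t) : ℝ :=
  f (env t h) a - ∑ d, (p t h).real {d} * f (env t h) d

include hf henv in
theorem measurable_roundRegret_mean (a : D) (t : ℕ) : Measurable (roundRegret f p env a t) := by
  refine ((hf a).comp (henv t)).sub (Finset.measurable_sum _ fun d _ => ?_)
  exact (((p t).measurable_coe (measurableSet_singleton d)).ennreal_toReal).mul
    ((hf d).comp (henv t))

include hC in
theorem abs_roundRegret_le (a : D) (t : ℕ) (h : History D O t) :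
    |roundRegret f p env a t h| ≤ C + C := by
  refine (abs_sub _ _).trans (add_le_add (hC _ _) ?_)
  refine (Finset.abs_sum_le_sum_abs _ _).trans ?_
  calc _ ≤ ∑ d, (p t h).real {d} * C := Finset.sum_le_sum fun d _ => by
        rw [abs_mul, abs_of_nonneg measureReal_nonneg]
        exact mul_le_mul_of_nonneg_left (hC _ d) measureReal_nonneg
    _ = C := by rw [← Finset.sum_mul, sum_real_singleton_eq_one, one_mul]

include hf hC in
theorem integral_cumulativeRegret_succ (a : D) (t : ℕ) :
    ∫ h, cumulativeRegret f env a (t + 1) h ∂(historyLaw obs p env henv (t + 1)) =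
      ∫ h, cumulativeRegret f env a t h ∂(historyLaw obs p env henv t) +
        ∫ h, roundRegret f p env a t h ∂(historyLaw obs p env henv t) := by
  have hm := ((measurable_cumulativeRegret henv hf a t).comp measurable_fst).add
    (measurable_roundRegret (O := O) hf henv a t)
  refine (integral_historyLaw_succ obs p henv t hm (C := t * (C + C) + (C + C)) fun x =>
    (abs_add_le _ _).trans (add_le_add (abs_cumulativeRegret_le hC a t x.1)
      ((abs_sub _ _).trans (add_le_add (hC _ _) (hC _ _))))).trans ?_
  rw [← integral_add (integrable_of_bounded (measurable_cumulativeRegret henv hf a t)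
    (abs_cumulativeRegret_le hC a t)) (integrable_of_bounded
      (measurable_roundRegret_mean p henv hf a t) (abs_roundRegret_le p hC a t))]
  refine integral_congr_ae (ae_of_all _ fun h => ?_)
  beta_reduce
  rw [integral_fintype (Integrable.of_finite)]
  simp only [Pi.add_apply, Function.comp_apply, smul_eq_mul, mul_add, mul_sub,
    Finset.sum_add_distrib, Finset.sum_sub_distrib, ← Finset.sum_mul, sum_real_singleton_eq_one,
    one_mul, roundRegret]

end Regret

/-! ### The regret of adaptive minimax sampling -/

section Main

variable {M D O : Type*} [MeasurableSpace M]
  [Fintype D] [Nonempty D] [MeasurableSpace D] [MeasurableSingletonClass D]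
  [MeasurableSpace O] [MetricSpace O] [BorelSpace O]
  {obs : Kernel (M × D) O} [IsMarkovKernel obs]
  {f : M → D → ℝ} (hf : ∀ d, Measurable fun m => f m d) {C : ℝ} (hC : ∀ m d, |f m d| ≤ C)
  {η : ℝ} (hη : 0 < η) {V : ℝ}
  (hV : ∀ (q p : Measure D) [IsProbabilityMeasure q] [IsProbabilityMeasure p]
    (ν : ProbabilityMeasure (M × D)), (∀ d, q {d} ≠ 0) → SolvesMinimax obs f η q p ν →
      ∑ d, p.real {d} * decisionValue obs f η q ν d ≤ V)
  {T : ℕ} {q p : ∀ t, Kernel (History D O t) D} [∀ t, IsMarkovKernel (q t)]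
  [∀ t, IsMarkovKernel (p t)] {ν : ∀ t, History D O t → ProbabilityMeasure (M × D)}
  (hams : IsAMS obs f η T q p ν) {env : ∀ t, History D O t → M}
  (henv : ∀ t, Measurable (env t)) (hdet : PosteriorsDetermined obs p ν env henv T)

theorem logLoss_uniformOn (a : D) :
    logLoss ((uniformOn (Set.univ : Set D)).real {a}) =
      ENNReal.ofReal (Real.log (Fintype.card D)) := by
  have h : (uniformOn (Set.univ : Set D)).real {a} = (Fintype.card D : ℝ)⁻¹ := by
    rw [Measure.real, uniformOn_univ]
    simp
  have hn : (Fintype.card D : ℝ) ≠ 0 := by exact_mod_cast Fintype.card_ne_zero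
  rw [h, logLoss, if_neg (inv_ne_zero hn), Real.log_inv, neg_neg]

theorem measurable_kernel_real {X : Type*} [MeasurableSpace X] (κ : Kernel X D) (a : D) :
    Measurable fun x => (κ x).real {a} :=
  (κ.measurable_coe (measurableSet_singleton a)).ennreal_toReal

include hf hC hη hV hams hdet

/-- One round: the expected log loss of the next reference distribution. -/
theorem lintegral_logLoss_update_le {t : ℕ} (ht : t < T) {h : History D O t}
    (hq : ∀ d, q t h {d} ≠ 0)
    (hac : ∀ d, p t h {d} ≠ 0 → obs (env t h, d) ≪ predictive obs (ν t h) d) (a : D) :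
    0 ≤ η * (V - roundRegret f p env a t h) - Real.log ((q t h).real {a}) ∧
    ∫⁻ d, ∫⁻ o, logLoss ((q (t + 1) (h, (d, o))).real {a}) ∂obs (env t h, d) ∂(p t h) ≤
      ENNReal.ofReal (η * (V - roundRegret f p env a t h) - Real.log ((q t h).real {a})) := by
  have hsol := hams.solves t ht h hq
  have hdom : ∀ ν : ProbabilityMeasure (M × D), ∀ b, (q t h).real {b} = 0 → priorReal ν b = 0 :=
    fun ν b h => absurd h (real_singleton_ne_zero hq b)
  obtain ⟨h1, h2⟩ := lintegral_logLoss_posterior_le (a := a) (m := env t h) (ν := ν t h)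
    (q := q t h) (p := p t h) obs hf hC hη (fun ν' => by
      have := hsol.2 ν'
      rwa [air_eq_sum obs f η _ (hdom _), air_eq_sum obs f η _ (hdom _),
        EReal.coe_le_coe_iff] at this) hac
  have hle : η * (∑ d, (p t h).real {d} * decisionValue obs f η (q t h) (ν t h) d -
      (f (env t h) a - ∑ d, (p t h).real {d} * f (env t h) d)) - Real.log ((q t h).real {a}) ≤
      η * (V - roundRegret f p env a t h) - Real.log ((q t h).real {a}) := by
    have := hV (q t h) (p t h) (ν t h) hq hsol
    rw [roundRegret]
    gcongr
  refine ⟨h1.trans hle, le_trans (lintegral_mono_ae ?_) (h2.trans (ENNReal.ofReal_le_ofReal hle))⟩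
  rw [ae_iff_of_countable]
  intro d hd
  refine lintegral_mono_ae ?_
  -- The update identifies the new reference distribution only up to null sets of the predicted law;
  -- absolute continuity transfers this to the law the environment uses.
  filter_upwards [(hac d hd).ae_le (hams.update t ht h d)] with o ho
  rw [ho, postReal]

/-- The expected log loss is the potential. Its bound must be carried for all a at once, because it
shows that the current reference distribution lies almost surely in the interior, which the next
round requires. The nonnegativity half prevents `ENNReal.ofReal` from truncating. -/
theorem lintegral_logLoss_le {t : ℕ} (ht : t ≤ T) (a : D) :
    0 ≤ Real.log (Fintype.card D) + η * (V * t -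
      ∫ h, cumulativeRegret f env a t h ∂(historyLaw obs p env henv t)) ∧
    ∫⁻ h, logLoss ((q t h).real {a}) ∂(historyLaw obs p env henv t) ≤
      ENNReal.ofReal (Real.log (Fintype.card D) + η * (V * t -
        ∫ h, cumulativeRegret f env a t h ∂(historyLaw obs p env henv t))) := by
  induction t generalizing a with
  | zero =>
    simp only [cumulativeRegret, hams.init, logLoss_uniformOn]
    simp [Real.log_natCast_nonneg]
  | succ t ih =>
    have ht' : t < T := ht
    replace ih := ih ht'.le
    set H := historyLaw obs p env henv t with hH
    have hmQ : ∀ a, Measurable fun h => (q t h).real {a} := measurable_kernel_real (q t)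
    -- Finite expected log loss at d excludes zero mass at d, almost surely.
    have hpos : ∀ᵐ h ∂H, ∀ d, q t h {d} ≠ 0 := by
      rw [ae_all_iff]
      intro d
      filter_upwards [ae_lt_top (measurable_logLoss.comp (hmQ d))
        ((ih d).2.trans_lt ENNReal.ofReal_lt_top).ne] with h hh h0
      simp [logLoss, Measure.real, h0] at hh
    have hround := fun h hq hac => lintegral_logLoss_update_le hf hC hη hV hams henv hdet ht'
      (h := h) hq hac a
    set Q : History D O t → ℝ := fun h => -Real.log ((q t h).real {a}) with hQ
    have hQ0 : ∀ h, 0 ≤ Q h := fun h =>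
      neg_nonneg.2 (Real.log_nonpos measureReal_nonneg measureReal_le_one)
    have hmQ' : Measurable Q := (hmQ a).log.neg
    have hQle : ∫⁻ h, ENNReal.ofReal (Q h) ∂H ≤ ENNReal.ofReal (Real.log (Fintype.card D) +
        η * (V * t - ∫ h, cumulativeRegret f env a t h ∂H)) := by
      refine (lintegral_mono fun h => ?_).trans (ih a).2
      rw [logLoss]
      split_ifs
      · exact le_top
      · exact le_rfl
    have hQi : Integrable Q H := by
      refine (lintegral_ofReal_ne_top_iff_integrable hmQ'.aestronglyMeasurable
        (ae_of_all _ hQ0)).1 (hQle.trans_lt ENNReal.ofReal_lt_top).ne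
    have hQint : ∫ h, Q h ∂H ≤ Real.log (Fintype.card D) +
        η * (V * t - ∫ h, cumulativeRegret f env a t h ∂H) := by
      rw [integral_eq_lintegral_of_nonneg_ae (ae_of_all _ hQ0) hmQ'.aestronglyMeasurable]
      exact ENNReal.toReal_le_of_le_ofReal (ih a).1 hQle
    have hRi : Integrable (roundRegret f p env a t) H :=
      integrable_of_bounded (measurable_roundRegret_mean p henv hf a t) (abs_roundRegret_le p hC a t)
    set Y : History D O t → ℝ := fun h => η * (V - roundRegret f p env a t h) + Q h with hY
    have hVRi : Integrable (fun h => η * (V - roundRegret f p env a t h)) H :=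
      ((integrable_const V).sub hRi).const_mul η
    have hYi : Integrable Y H := hVRi.add hQi
    have hgood : ∀ᵐ h ∂H, 0 ≤ Y h ∧
        ∫⁻ d, ∫⁻ o, logLoss ((q (t + 1) (h, (d, o))).real {a}) ∂obs (env t h, d) ∂(p t h) ≤
          ENNReal.ofReal (Y h) := by
      filter_upwards [hpos, hdet t ht'] with h h1 h2
      simpa only [hY, hQ, ← sub_eq_add_neg] using hround h h1 h2
    have hYint : ∫ h, Y h ∂H ≤ Real.log (Fintype.card D) + η * (V * (t + 1 : ℕ) -
        ∫ h, cumulativeRegret f env a (t + 1) h ∂(historyLaw obs p env henv (t + 1))) := by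
      rw [integral_cumulativeRegret_succ obs p henv hf hC, hY, integral_add hVRi hQi,
        integral_const_mul, integral_sub (integrable_const V) hRi]
      simp only [integral_const, probReal_univ, one_smul, Nat.cast_add, Nat.cast_one]
      linarith
    refine ⟨(integral_nonneg_of_ae (hgood.mono fun h hh => hh.1)).trans hYint, ?_⟩
    rw [lintegral_historyLaw_succ obs p henv t (g := fun h => logLoss ((q (t + 1) h).real {a}))
      (measurable_logLoss.comp (measurable_kernel_real (q (t + 1)) a))]
    refine (lintegral_mono_ae (hgood.mono fun h hh => hh.2)).trans ?_
    rw [← ofReal_integral_eq_lintegral_ofReal hYi (hgood.mono fun h hh => hh.1)]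
    exact ENNReal.ofReal_le_ofReal hYint

/-- The regret of adaptive minimax sampling is controlled by any upper bound `V` of the minimax
values of the algorithmic information ratio. -/
theorem regret_le : regret obs f p env henv T ≤ Real.log (Fintype.card D) / η + V * T := by
  refine ciSup_le fun a => ?_
  -- The nonnegativity half alone, at time T, is the regret bound multiplied by η.
  have h := (lintegral_logLoss_le hf hC hη hV hams henv hdet le_rfl a).1
  rw [← sub_le_iff_le_add, le_div_iff₀ hη]
  linarith

end Main

end AMS

theorem theorem3p3 {M : Type*} {D : Type*} {O : Type*}
    [MetricSpace M] [CompactSpace M] [Nonempty M] [MeasurableSpace M] [BorelSpace M]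
    [Fintype D] [Nonempty D] [MeasurableSpace D] [MeasurableSingletonClass D]
    [MetricSpace O] [MeasurableSpace O] [BorelSpace O]
    (obs : Kernel (M × D) O) [IsMarkovKernel obs]
    (hobs : ∀ d, Continuous fun m : M => AMS.obsLaw obs d m)
    (f : M → D → ℝ) (hf : ∀ d, Continuous fun m : M => f m d)
    (η : ℝ) (hη : 0 < η) :
    (∀ q : ProbabilityMeasure D, (∀ d, (q : Measure D) {d} ≠ 0) →
      ∃ (p : ProbabilityMeasure D) (ν : ProbabilityMeasure (M × D)),
        AMS.IsSaddlePoint obs f η q p ν) ∧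
    ∀ (T : ℕ) (q p : ∀ t, Kernel (AMS.History D O t) D)
      [∀ t, IsMarkovKernel (q t)] [∀ t, IsMarkovKernel (p t)]
      (ν : ∀ t, AMS.History D O t → ProbabilityMeasure (M × D)),
      AMS.IsAMS obs f η T q p ν →
      ∀ (env : ∀ t, AMS.History D O t → M) (henv : ∀ t, Measurable (env t)),
        AMS.PosteriorsDetermined obs p ν env henv T →
        (AMS.regret obs f p env henv T : EReal) ≤
            ((Real.log (Fintype.card D) / η : ℝ) : EReal) + AMS.decKLConv obs f η * (T : EReal) ∧
          (η = 2 * √(Real.log (Fintype.card D) / ((AMS.irIDS obs f).toReal * T)) →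
            AMS.regret obs f p env henv T ≤
              √(Real.log (Fintype.card D) * (AMS.irIDS obs f).toReal * T)) := by
  refine ⟨fun q hq => AMS.exists_isSaddlePoint obs hobs hf hη q hq, ?_⟩
  intro T q p _ _ ν hams env henv hdet
  have hfm : ∀ d, Measurable fun m => f m d := fun d => (hf d).measurable
  obtain ⟨C, hC⟩ := AMS.exists_abs_reward_le hf
  constructor
  -- With T = 0 both sides are explicit even if the DEC is infinite, as multiplication by 0 gives 0
  -- in `EReal`.
  · rcases Nat.eq_zero_or_pos T with rfl | hT
    · have h0 : AMS.regret obs f p env henv 0 = 0 := by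
        simp [AMS.regret, AMS.cumulativeRegret]
      rw [h0, Nat.cast_zero, mul_zero, add_zero, EReal.coe_le_coe_iff]
      exact div_nonneg (Real.log_natCast_nonneg _) hη.le
    have hT0 : (0 : ℝ) < T := by exact_mod_cast hT
    have hcast : ((T : ℕ) : EReal) = ((T : ℝ) : EReal) := by simp
    by_cases htop : AMS.decKLConv obs f η = ⊤
    · rw [htop, hcast, EReal.top_mul_coe_of_pos hT0, EReal.coe_add_top]
      exact le_top
    have hle : ∀ (q' p' : Measure D) [IsProbabilityMeasure q'] [IsProbabilityMeasure p']
        (ν' : ProbabilityMeasure (M × D)), (∀ d, q' {d} ≠ 0) →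
        AMS.SolvesMinimax obs f η q' p' ν' →
        ((∑ d, p'.real {d} * AMS.decisionValue obs f η q' ν' d : ℝ) : EReal) ≤
          AMS.decKLConv obs f η := by
      intro q' p' _ _ ν' hq' hsol
      obtain ⟨ν'', hν''⟩ := hsol.exists_le_decisionValue obs hobs hf hη hq'
      exact AMS.le_decKLConv obs ν'' hfm hC hη hq' hν''
    -- The first round, which exists as T > 0, starts from the uniform distribution and has a real
    -- value below the DEC.
    have hbot : AMS.decKLConv obs f η ≠ ⊥ := by
      intro hbot
      let h₀ : AMS.History D O 0 := PUnit.unit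
      have h0 : ∀ h d, q 0 h {d} ≠ 0 := fun h d => by
        rw [hams.init h, uniformOn_univ]
        simp
      have := hle (q 0 h₀) (p 0 h₀) _ (h0 _) (hams.solves 0 hT _ (h0 _))
      rw [hbot, le_bot_iff] at this
      exact EReal.coe_ne_bot _ this
    have hreg := AMS.regret_le (V := (AMS.decKLConv obs f η).toReal) hfm hC hη
      (fun q' p' _ _ ν' hq' hsol => by
        have := EReal.toReal_le_toReal (hle q' p' ν' hq' hsol) (EReal.coe_ne_bot _) htop
        rwa [EReal.toReal_coe] at this) hams henv hdet
    rw [← EReal.coe_le_coe_iff] at hreg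
    refine hreg.trans_eq ?_
    rw [EReal.coe_add, EReal.coe_mul, EReal.coe_toReal htop hbot, hcast]
  · intro hηeq
    set L := Real.log (Fintype.card D)
    set K := (AMS.irIDS obs f).toReal
    have hK0 : 0 ≤ K := ENNReal.toReal_nonneg
    have hT0 : (0 : ℝ) ≤ T := T.cast_nonneg
    -- Positivity of η in its formula forces the remaining conditions: a zero denominator would make
    -- the quotient 0, and an infinite ratio would have `toReal` equal to 0.
    have hsqrt : 0 < √(L / (K * T)) := by linarith
    have hdiv : 0 < L / (K * T) := Real.sqrt_pos.1 hsqrt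
    have hKT : 0 < K * T := by
      refine (mul_nonneg hK0 hT0).lt_of_ne fun h0 => ?_
      rw [← h0, div_zero] at hdiv
      exact lt_irrefl _ hdiv
    have hfin : AMS.irIDS obs f ≠ ⊤ := fun h => by
      have : K = 0 := by simp [K, h]
      rw [this, zero_mul] at hKT
      exact lt_irrefl _ hKT
    have hreg := AMS.regret_le (V := η / 4 * K) hfm hC hη
      (fun q' p' _ _ ν' hq' hsol => by
        obtain ⟨ν'', hν''⟩ := hsol.exists_le_decisionValue obs hobs hf hη hq'
        exact AMS.le_mul_toReal_irIDS obs hη hq' hν'' hfin) hams henv hdet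
    refine hreg.trans_eq ?_
    change L / η + _ = _
    -- The learning rate balances the two terms: L/η and ηKT/4 coincide, and their sum ηKT/2 is the
    -- square root of L K T.
    have hL : L = η ^ 2 / 4 * (K * T) := by
      have h1 : η ^ 2 / 4 = L / (K * T) := by
        rw [hηeq, mul_pow, Real.sq_sqrt hdiv.le]; ring
      rw [h1, div_mul_cancel₀ _ hKT.ne']
    have hR : L * K * T = (η / 2 * (K * T)) ^ 2 := by rw [mul_assoc, hL]; ring
    rw [hR, Real.sqrt_sq (by positivity), hL]
    field_simp
    ring
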